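/- All operators are bounded linear operators on complex Hilbert spaces. The tetrablock is $\mathbb E=\{(a_{11},a_{22},\det A): A=[a_{ij}]\in M_2(\mathbb C),\ \|A\|<1\}\subset\mathbb C^3$, and $b\overline{\mathbb E}=\{(x_1,x_2,x_3)\in\overline{\mathbb E}: |x_3|=1\}$. Let $(A,B,P)$ be a triple of commuting operators on a Hilbert space $\mathcal H$, with Taylor joint spectrum $\sigma_T(A,B,P)$. The triple is an $\mathbb E$-contraction if $\overline{\mathbb E}$ is a spectral set for it, i.e. $\sigma_T(A,B,P)\subseteq\overline{\mathbb E}$ and $\|f(A,B,P)\|\le\sup_{z\in\overline{\mathbb E}}|f(z)|$ for every rational function $f=p/q$ with $p,q\in\mathbb C[z_1,z_2,z_3]$ and $q$ without zeros in $\overline{\mathbb E}$, where $f(A,B,P)=p(A,B,P)\,q(A,B,P)^{-1}$. It is an $\mathbb E$-unitary if $A,B,P$ are normal and $\sigma_T(A,B,P)\subseteq b\overline{\mathbb E}$, and an $\mathbb E$-isometry if it is the restriction of an $\mathbb E$-unitary, acting on a Hilbert space containing $\mathcal H$, to the joint invariant subspace $\mathcal H$. An $\mathbb E$-contraction is a triangular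 $\mathbb E$-contraction if it has the form $(T_1,T_2,T_1T_2)$ with $T_1,T_2$ commuting contractions; it is a triangular $\mathbb E$-isometry if in addition it is an $\mathbb E$-isometry. Such a triple is called pure if its third entry $P$ is a pure (i.e. $C_{\cdot 0}$) contraction: $P^{*n}\to0$ strongly as $n\to\infty$. A commuting triple $(V_1,V_2,V_3)$ on a Hilbert space $\mathcal K\supseteq\mathcal H$ dilates $(T_1,T_2,T_3)$ on $\mathcal H$ if $P_{\mathcal H}(V_1^{m_1}V_2^{m_2}V_3^{n})|_{\mathcal H}=T_1^{m_1}T_2^{m_2}T_3^{n}$ for all integers $m_1,m_2,n\ge0$, where $P_{\mathcal H}$ is the orthogonal projection of $\mathcal K$ onto $\mathcal H$. Theorem. Every triangular $\mathbb E$-contraction dilates to a triangular $\mathbb E$-isometry, and every pure triangular $\mathbb E$-contraction dilates to a pure triangular $\mathbb E$-isometry. -/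

import Mathlib

open Filter Topology

universe u

noncomputable section

namespace TetrablockOperators

/-- The tetrablock: all `(a₁₁, a₂₂, det A)` with `A` a complex `2 × 2` matrix whose operator norm
on the Hilbert space `ℂ²` is less than one. -/
def tetrablock : Set (Fin 3 → ℂ) :=
  {z | ∃ A : Matrix (Fin 2) (Fin 2) ℂ,
      ‖Matrix.toEuclideanCLM (n := Fin 2) (𝕜 := ℂ) A‖ < 1 ∧ z = ![A 0 0, A 1 1, A.det]}

/-- The closed tetrablock. -/
def closedTetrablock : Set (Fin 3 → ℂ) := closure tetrablock

/-- The distinguished boundary of the tetrablock. -/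
def distinguishedBoundary : Set (Fin 3 → ℂ) := {z | z ∈ closedTetrablock ∧ ‖z 2‖ = 1}

section Operators

variable {H : Type u} [NormedAddCommGroup H] [InnerProductSpace ℂ H]

/-- The entries of the triple of operators commute with each other. -/
def IsCommutingTriple (T : Fin 3 → (H →L[ℂ] H)) : Prop := ∀ i j, Commute (T i) (T j)

/-- First map `H → H³` of the Koszul complex of a triple. -/
def koszul₀ (S : Fin 3 → (H →L[ℂ] H)) (x : H) : H × H × H := (S 0 x, S 1 x, S 2 x)

/-- Second map `H³ → H³` of the Koszul complex of a triple (in the basis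
`e₂ ∧ e₃, e₃ ∧ e₁, e₁ ∧ e₂`). -/
def koszul₁ (S : Fin 3 → (H →L[ℂ] H)) (x : H × H × H) : H × H × H :=
  (S 1 x.2.2 - S 2 x.2.1, S 2 x.1 - S 0 x.2.2, S 0 x.2.1 - S 1 x.1)

/-- Last map `H³ → H` of the Koszul complex of a triple. -/
def koszul₂ (S : Fin 3 → (H →L[ℂ] H)) (x : H × H × H) : H := S 0 x.1 + S 1 x.2.1 + S 2 x.2.2

/-- Exactness of the Koszul complex `0 → H → H³ → H³ → H → 0` at all of its places. -/
def KoszulExact (S : Fin 3 → (H →L[ℂ] H)) : Prop :=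
  Function.Injective (koszul₀ S) ∧ Function.Exact (koszul₀ S) (koszul₁ S) ∧
    Function.Exact (koszul₁ S) (koszul₂ S) ∧ Function.Surjective (koszul₂ S)

/-- The Taylor joint spectrum of a commuting triple: all `z` for which the Koszul complex of
`T - z` is not exact. -/
def taylorSpectrum (T : Fin 3 → (H →L[ℂ] H)) : Set (Fin 3 → ℂ) :=
  {z | ¬ KoszulExact (fun i => T i - z i • (1 : H →L[ℂ] H))}

/-- The value `p(T₁, T₂, T₃)` of a polynomial at a (commuting) triple of operators. -/
def polyEval (p : MvPolynomial (Fin 3) ℂ) (T : Fin 3 → (H →L[ℂ] H)) : H →L[ℂ] H :=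
  ∑ m ∈ p.support, p.coeff m • (T 0 ^ m 0 * T 1 ^ m 1 * T 2 ^ m 2)

/-- `T` is an `𝔼`-contraction: the closed tetrablock is a spectral set for the commuting triple
`T`. The von Neumann inequality `‖p(T) q(T)⁻¹‖ ≤ sup |p / q|` is written as a bound by every upper
bound `M` of `|p / q|` on the closed tetrablock; invertibility of `q(T)`, which the inequality
presupposes, is stated explicitly. -/
structure IsEContraction (T : Fin 3 → (H →L[ℂ] H)) : Prop where
  commute : IsCommutingTriple T
  spectrum_subset : taylorSpectrum T ⊆ closedTetrablock
  isUnit : ∀ q : MvPolynomial (Fin 3) ℂ, (∀ z ∈ closedTetrablock, MvPolynomial.eval z q ≠ 0) →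
    IsUnit (polyEval q T)
  vonNeumann : ∀ p q : MvPolynomial (Fin 3) ℂ,
    (∀ z ∈ closedTetrablock, MvPolynomial.eval z q ≠ 0) →
    ∀ M : ℝ, (∀ z ∈ closedTetrablock, ‖MvPolynomial.eval z p / MvPolynomial.eval z q‖ ≤ M) →
      ‖polyEval p T * Ring.inverse (polyEval q T)‖ ≤ M

/-- `T = (P, Q, PQ)` for a pair of commuting contractions `P, Q`. -/
def IsTriangular (T : Fin 3 → (H →L[ℂ] H)) : Prop :=
  ∃ P Q : H →L[ℂ] H, Commute P Q ∧ ‖P‖ ≤ 1 ∧ ‖Q‖ ≤ 1 ∧ T = ![P, Q, P * Q]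

/-- Triangular `𝔼`-contractions. -/
def IsTriangularEContraction (T : Fin 3 → (H →L[ℂ] H)) : Prop :=
  IsEContraction T ∧ IsTriangular T

variable [CompleteSpace H]

/-- A pure (that is, `C.₀`) contraction: the powers of the adjoint tend strongly to zero. -/
def IsPureContraction (P : H →L[ℂ] H) : Prop :=
  ‖P‖ ≤ 1 ∧ ∀ h : H, Tendsto (fun n : ℕ => (ContinuousLinearMap.adjoint P ^ n) h) atTop (𝓝 0)

/-- `𝔼`-unitaries: commuting normal operators with Taylor joint spectrum in the distinguished
boundary of the tetrablock. -/
structure IsEUnitary (T : Fin 3 → (H →L[ℂ] H)) : Prop where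
  commute : IsCommutingTriple T
  normal : ∀ i, IsStarNormal (T i)
  spectrum_subset : taylorSpectrum T ⊆ distinguishedBoundary

/-- `𝔼`-isometries: commuting triples that are the restriction of an `𝔼`-unitary `N` on a larger
Hilbert space `L` to a joint invariant subspace; `H` sits in `L` by the isometric embedding `j`. -/
def IsEIsometry (T : Fin 3 → (H →L[ℂ] H)) : Prop :=
  IsCommutingTriple T ∧
    ∃ (L : Type u) (_ : NormedAddCommGroup L) (_ : InnerProductSpace ℂ L) (_ : CompleteSpace L)
      (j : H →ₗᵢ[ℂ] L) (N : Fin 3 → (L →L[ℂ] L)),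
      IsEUnitary N ∧ ∀ i h, N i (j h) = j (T i h)

/-- Triangular `𝔼`-isometries: `𝔼`-contractions that are `𝔼`-isometries and of the form
`(P, Q, PQ)` for a pair of commuting contractions. -/
structure IsTriangularEIsometry (T : Fin 3 → (H →L[ℂ] H)) : Prop where
  isEContraction : IsEContraction T
  isEIsometry : IsEIsometry T
  isTriangular : IsTriangular T

/-- The triple `V` on `K` dilates the triple `T` on `H`, where `H` is regarded as a subspace of `K`
by the isometric embedding `j`. The adjoint of `j` is the orthogonal projection of `K` onto `H`. -/
def IsDilation {K : Type u} [NormedAddCommGroup K] [InnerProductSpace ℂ K] [CompleteSpace K]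
    (j : H →ₗᵢ[ℂ] K) (V : Fin 3 → (K →L[ℂ] K)) (T : Fin 3 → (H →L[ℂ] H)) : Prop :=
  ∀ (m₁ m₂ n : ℕ) (h : H),
    ContinuousLinearMap.adjoint j.toContinuousLinearMap ((V 0 ^ m₁ * V 1 ^ m₂ * V 2 ^ n) (j h)) =
      (T 0 ^ m₁ * T 1 ^ m₂ * T 2 ^ n) h

end Operators

end TetrablockOperators

end

/-!
A triangular `𝔼`-contraction is `(P, Q, PQ)` with commuting contractions `P` and `Q`, so the
dilation problem is the one for the pair `(P, Q)`, which Ando's theorem solves. Two things remain: triples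
`(V₁, V₂, V₁V₂)` which restrict commuting unitaries have to be recognized as `𝔼`-contractions, and
purity of `PQ` has to pass to the dilation.

*Triples `(V₁, V₂, V₁V₂)`.* For commuting `V₁, V₂` the triple has its Taylor spectrum on the variety
`z₃ = z₁z₂` over `σ(V₁) × σ(V₂)`: otherwise the ideal generated by the `Vᵢ - zᵢ` contains `1`, and
then the Koszul complex is exact (`koszulExact_of_sum_mul_eq_one`). Over the closed bidisc this
variety lies in the closed tetrablock, and over the torus it lies in the distinguished boundary. By
Gelfand theory, `q(V)` is invertible if `q` has no zeros there (`isUnit_polyEval`). For unitaries,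
`p(U) q(U)⁻¹` is normal, and its spectrum consists of values of `p / q`, since `p - λ q` has a zero
when `λ` is in the spectrum; this gives the von Neumann inequality
(`norm_polyEval_mul_inverse_le`), which restrictions inherit
(`isTriangularEIsometry_of_unitary_extension`).

*Ando's theorem.* With a projection `p` on `E`, `q = 1 - p`, and defect operators `a, b` of `P, Q`
with values in `q E` and `p E`, let `R₁` and `R₂` act on `H ⊕ ℓ²(E)` as `P` and `Q` on `H`, shifting
the `q`-components and the `p`-components of a sequence, respectively, and feeding in `a h` and
`b h` (`exists_partial_shift`). Both `R₁R₂` and `R₂R₁` act as `PQ` on `H` and shift the whole sequence;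
only the entering vectors `b h + a Q h` and `a h + b P h` differ. They have the same norm, so a
unitary `W` of `E` carries the second to the first; it is obtained as the Halmos dilation of a partial
isometry, which avoids any comparison of dimensions (`exists_ando_unitary`). If `G` denotes `W`
acting coordinatewise, `R₁ G⁻¹` and `G R₂` are commuting isometries. They extend to unitaries
(`exists_commuting_unitary_extension`): the product `V` of two commuting isometries has a unitary
extension `W`, and each of the two extends as the strong limit of its conjugates by `Wⁿ` to the
subspace of those vectors whose orbits under `W` approach the space of `V`.

*Purity.* Restrict the unitaries to the closed invariant subspace generated by `H`. By minimality,
`Vᵢ*` extends `P*`, respectively `Q*`. As `V₁` and `V₂` are isometries,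
`(V₁V₂)*ⁿ⁺ᵃ⁺ᵇ V₁ᵃ V₂ᵇ h = (PQ)*ⁿ P*ᵇ Q*ᵃ h`, which tends to zero if `PQ` is pure. These vectors
span a dense subspace, so `V₁V₂` is pure
(`exists_isTriangularEIsometry_of_unitary_dilation`).
-/

noncomputable section

namespace TetrablockOperators

/-! ### Koszul exactness and the Taylor spectrum of `(P, Q, PQ)` -/

section KoszulComplex

variable {H : Type u} [NormedAddCommGroup H] [InnerProductSpace ℂ H]

theorem koszulExact_of_sum_mul_eq_one (S C : Fin 3 → (H →L[ℂ] H)) (hS : IsCommutingTriple S)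
    (hC : ∀ i j, Commute (C i) (S j)) (h : C 0 * S 0 + C 1 * S 1 + C 2 * S 2 = 1) :
    KoszulExact S := by
  have hS' : ∀ i j y, S i (S j y) = S j (S i y) := fun i j y => congr($(hS i j) y)
  have hC' : ∀ i j y, S i (C j y) = C j (S i y) := fun i j y => congr($((hC j i).symm) y)
  have h1 : ∀ y, C 0 (S 0 y) + C 1 (S 1 y) + C 2 (S 2 y) = y := fun y => congr($h y)
  refine ⟨fun x y hxy => ?_, fun y => ⟨fun hy => ?_, ?_⟩, fun y => ⟨fun hy => ?_, ?_⟩, fun y => ?_⟩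
  · simp only [koszul₀, Prod.mk.injEq] at hxy
    rw [← h1 x, ← h1 y, hxy.1, hxy.2.1, hxy.2.2]
  · obtain ⟨y0, y1, y2⟩ := y
    simp only [koszul₁, Prod.mk_eq_zero, sub_eq_zero] at hy
    obtain ⟨e0, e1, e2⟩ := hy
    refine ⟨C 0 y0 + C 1 y1 + C 2 y2, ?_⟩
    simp only [koszul₀, map_add, hC', Prod.mk.injEq]
    refine ⟨?_, ?_, ?_⟩
    · rw [e2, ← e1, h1]
    · rw [← e2, e0, h1]
    · rw [e1, ← e0, h1]
  · rintro ⟨x, rfl⟩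
    simp only [koszul₀, koszul₁, hS' 1 2, hS' 2 0, hS' 0 1, sub_self]
    rfl
  · obtain ⟨y0, y1, y2⟩ := y
    simp only [koszul₂] at hy
    have key : ∀ i, C i (S 0 y0) + C i (S 1 y1) + C i (S 2 y2) = 0 := fun i => by
      rw [← map_add, ← map_add, hy, map_zero]
    -- with `S · C = 1` and `S · y = 0`, the cross product identity gives `S × (y × C) = y`
    refine ⟨(C 2 y1 - C 1 y2, C 0 y2 - C 2 y0, C 1 y0 - C 0 y1), ?_⟩
    simp only [koszul₁, map_sub, hC', Prod.mk.injEq]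
    refine ⟨?_, ?_, ?_⟩
    · linear_combination (norm := module) h1 y0 - key 0
    · linear_combination (norm := module) h1 y1 - key 1
    · linear_combination (norm := module) h1 y2 - key 2
  · rintro ⟨⟨x0, x1, x2⟩, rfl⟩
    simp only [koszul₂, koszul₁, map_sub, hS' 1 0, hS' 2 0, hS' 2 1]
    abel
  · exact ⟨(C 0 y, C 1 y, C 2 y), by simp only [koszul₂, hC', h1]⟩

theorem notMem_taylorSpectrum {T C : Fin 3 → (H →L[ℂ] H)} {z : Fin 3 → ℂ}
    (hT : IsCommutingTriple T) (hC : ∀ i j, Commute (C i) (T j))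
    (h : C 0 * (T 0 - z 0 • 1) + C 1 * (T 1 - z 1 • 1) + C 2 * (T 2 - z 2 • 1) = 1) :
    z ∉ taylorSpectrum T := by
  have comm_sub : ∀ {A B : H →L[ℂ] H} {c : ℂ}, Commute A B → Commute A (B - c • 1) := fun hAB =>
    hAB.sub_right ((Commute.one_right _).smul_right _)
  simp only [taylorSpectrum, Set.mem_ofPred_eq, not_not]
  exact koszulExact_of_sum_mul_eq_one _ C
    (fun i j => comm_sub (comm_sub (hT j i)).symm) (fun i j => comm_sub (hC i j)) h

theorem IsCommutingTriple.of_commute {P Q : H →L[ℂ] H} (h : Commute P Q) :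
    IsCommutingTriple ![P, Q, P * Q] := by
  intro i j
  fin_cases i <;> fin_cases j <;>
    simp [h, h.symm, (Commute.refl P).mul_right h, h.symm.mul_right (Commute.refl Q),
      ((Commute.refl P).mul_right h).symm, (h.symm.mul_right (Commute.refl Q)).symm]

/-- One inclusion of the joint spectral mapping theorem for `(P, Q, PQ)`: the third coordinate is
the product of the others, which lie in the spectra of `P` and `Q`. -/
theorem mem_taylorSpectrum_mul {P Q : H →L[ℂ] H} (h : Commute P Q) {z : Fin 3 → ℂ}
    (hz : z ∈ taylorSpectrum ![P, Q, P * Q]) :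
    z 0 ∈ spectrum ℂ P ∧ z 1 ∈ spectrum ℂ Q ∧ z 2 = z 0 * z 1 := by
  have hT := IsCommutingTriple.of_commute h
  refine ⟨?_, ?_, ?_⟩
  · by_contra hu
    rw [spectrum.notMem_iff, ← IsUnit.neg_iff, neg_sub, Algebra.algebraMap_eq_smul_one] at hu
    obtain ⟨v, hv⟩ := hu
    refine notMem_taylorSpectrum (C := ![↑v⁻¹, 0, 0]) hT (fun i j => ?_) ?_ hz
    · have : Commute (↑v⁻¹ : H →L[ℂ] H) (![P, Q, P * Q] j) := by
        refine Commute.units_inv_left ?_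
        rw [hv]
        exact (hT 0 j).sub_left ((Commute.one_left _).smul_left _)
      fin_cases i <;> simp [this]
    · simp [← hv]
  · by_contra hu
    rw [spectrum.notMem_iff, ← IsUnit.neg_iff, neg_sub, Algebra.algebraMap_eq_smul_one] at hu
    obtain ⟨v, hv⟩ := hu
    refine notMem_taylorSpectrum (C := ![0, ↑v⁻¹, 0]) hT (fun i j => ?_) ?_ hz
    · have : Commute (↑v⁻¹ : H →L[ℂ] H) (![P, Q, P * Q] j) := by
        refine Commute.units_inv_left ?_
        rw [hv]
        exact (hT 1 j).sub_left ((Commute.one_left _).smul_left _)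
      fin_cases i <;> simp [this]
    · simp [← hv]
  · by_contra hne
    have hne' : z 2 - z 0 * z 1 ≠ 0 := sub_ne_zero.2 hne
    -- `P (Q - z₁) + z₁ (P - z₀) - (PQ - z₂) = z₂ - z₀ z₁` is an invertible scalar
    refine notMem_taylorSpectrum (z := z)
      (C := ![(z 2 - z 0 * z 1)⁻¹ • z 1 • 1, (z 2 - z 0 * z 1)⁻¹ • P, -((z 2 - z 0 * z 1)⁻¹ • 1)])
      hT (fun i j => ?_) ?_ hz
    · fin_cases i
      · exact ((Commute.one_left _).smul_left _).smul_left _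
      · exact (hT 0 j).smul_left _
      · exact ((Commute.one_left _).smul_left _).neg_left
    · have : (z 2 - z 0 * z 1)⁻¹ • (z 2 - z 0 * z 1) • (1 : H →L[ℂ] H) = 1 := by
        rw [smul_smul, inv_mul_cancel₀ hne', one_smul]
      refine Eq.trans ?_ this
      simp only [Matrix.cons_val, smul_mul_assoc, one_mul, neg_mul, mul_sub, mul_smul_comm, mul_one]
      generalize (z 2 - z 0 * z 1)⁻¹ = c
      module

end KoszulComplex

/-! ### Polynomials and rational functions of commuting operators -/

section FunctionalCalculus

variable {H : Type u} [NormedAddCommGroup H] [InnerProductSpace ℂ H]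

theorem polyEval_map {A : Type*} [CommRing A] [Algebra ℂ A] (φ : A →ₐ[ℂ] (H →L[ℂ] H))
    (t : Fin 3 → A) (p : MvPolynomial (Fin 3) ℂ) :
    polyEval p (fun i => φ (t i)) = φ (MvPolynomial.aeval t p) := by
  rw [MvPolynomial.aeval_def, MvPolynomial.eval₂_eq', map_sum]
  simp only [polyEval, Fin.prod_univ_three, Algebra.algebraMap_eq_smul_one, smul_mul_assoc,
    one_mul, map_smul, map_mul, map_pow]

theorem commute_polyEval {X : H →L[ℂ] H} {T : Fin 3 → (H →L[ℂ] H)}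
    (h : ∀ i, Commute X (T i)) (p : MvPolynomial (Fin 3) ℂ) : Commute X (polyEval p T) :=
  Commute.sum_right _ _ _ fun _ _ => Commute.smul_right
    ((((h 0).pow_right _).mul_right ((h 1).pow_right _)).mul_right ((h 2).pow_right _)) _

theorem polyEval_intertwine {K : Type u} [NormedAddCommGroup K] [InnerProductSpace ℂ K]
    {T : Fin 3 → (H →L[ℂ] H)} {N : Fin 3 → (K →L[ℂ] K)} (j : H →ₗᵢ[ℂ] K)
    (h : ∀ i x, N i (j x) = j (T i x)) (p : MvPolynomial (Fin 3) ℂ) (x : H) :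
    polyEval p N (j x) = j (polyEval p T x) := by
  have hpow : ∀ i (n : ℕ) x, (N i ^ n) (j x) = j ((T i ^ n) x) := by
    intro i n
    induction n with
    | zero => simp
    | succ n ih => intro x; simp [pow_succ, h, ih]
  simp [polyEval, hpow]

variable [CompleteSpace H]

theorem norm_le_one_of_mem_unitary {U : H →L[ℂ] H} (hU : U ∈ unitary (H →L[ℂ] H)) : ‖U‖ ≤ 1 := by
  nontriviality H →L[ℂ] H
  exact (CStarRing.norm_of_mem_unitary hU).le

/-- Commuting operators live in a common commutative Banach algebra of operators: the closed
algebra which they generate. -/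
theorem exists_commutative_banachAlgebra {P Q : H →L[ℂ] H} (h : Commute P Q) :
    ∃ (A : Type u) (_ : NormedCommRing A) (_ : NormedAlgebra ℂ A) (_ : CompleteSpace A)
      (φ : A →ₐ[ℂ] (H →L[ℂ] H)) (a b : A), φ a = P ∧ φ b = Q ∧ ∀ x, ‖φ x‖ = ‖x‖ := by
  have hc : ∀ a ∈ ({P, Q} : Set (H →L[ℂ] H)), ∀ b ∈ ({P, Q} : Set (H →L[ℂ] H)),
      a * b = b * a := by
    rintro a (rfl | rfl) b (rfl | rfl)
    exacts [rfl, h, h.symm, rfl]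
  let S := (Algebra.adjoin ℂ ({P, Q} : Set (H →L[ℂ] H))).topologicalClosure
  have hsub := Subalgebra.le_topologicalClosure (Algebra.adjoin ℂ ({P, Q} : Set (H →L[ℂ] H)))
  have hmul : ∀ x y : S, x * y = y * x :=
    ((Algebra.adjoin ℂ {P, Q}).commRingTopologicalClosure
      (Algebra.isMulCommutative_adjoin ℂ hc).is_comm.comm).mul_comm
  let I : NormedCommRing S := { (inferInstance : NormedRing S) with mul_comm := hmul }
  exact ⟨S, I, inferInstanceAs (NormedAlgebra ℂ S),
    (Subalgebra.isClosed_topologicalClosure _).completeSpace_coe, S.val,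
    ⟨P, hsub (Algebra.subset_adjoin (by simp))⟩, ⟨Q, hsub (Algebra.subset_adjoin (by simp))⟩,
    rfl, rfl, fun x => rfl⟩

/-- By Gelfand theory, a polynomial without zeros on the variety `z₃ = z₁ z₂` over the closed
bidisc is invertible at `(P, Q, PQ)` for commuting contractions `P` and `Q`. -/
theorem isUnit_polyEval {P Q : H →L[ℂ] H} (h : Commute P Q) (hP : ‖P‖ ≤ 1) (hQ : ‖Q‖ ≤ 1)
    (q : MvPolynomial (Fin 3) ℂ)
    (hq : ∀ a b : ℂ, ‖a‖ ≤ 1 → ‖b‖ ≤ 1 → MvPolynomial.eval ![a, b, a * b] q ≠ 0) :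
    IsUnit (polyEval q ![P, Q, P * Q]) := by
  nontriviality H →L[ℂ] H
  have : Nontrivial H := by
    by_contra hH
    rw [not_nontrivial_iff_subsingleton] at hH
    exact not_nontrivial (H →L[ℂ] H) ‹_›
  obtain ⟨A, _, _, _, φ, a, b, rfl, rfl, hφ⟩ := exists_commutative_banachAlgebra h
  have hT : (![φ a, φ b, φ a * φ b] : Fin 3 → (H →L[ℂ] H)) = fun i => φ (![a, b, a * b] i) := by
    ext1 i; fin_cases i <;> simp
  rw [hT, polyEval_map]
  refine IsUnit.map φ ?_
  by_contra hu
  have : NormOneClass A := ⟨by rw [← hφ, map_one, norm_one]⟩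
  obtain ⟨χ, hχ⟩ := WeakDual.CharacterSpace.exists_apply_eq_zero hu
  have hle : ∀ x : A, ‖χ x‖ ≤ ‖x‖ := fun x => AlgHom.norm_apply_le_self χ x
  refine hq (χ a) (χ b) ((hle a).trans (hφ a ▸ hP)) ((hle b).trans (hφ b ▸ hQ)) ?_
  have h2 : (fun i => χ (![a, b, a * b] i)) = ![χ a, χ b, χ a * χ b] := by
    ext1 i; fin_cases i <;> simp
  rw [← hχ, ← h2, MvPolynomial.eval_eq', MvPolynomial.aeval_def, MvPolynomial.eval₂_eq', map_sum]
  simp only [map_mul, map_prod, map_pow, AlgHomClass.commutes, Algebra.algebraMap_self_apply]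

theorem polyEval_sub_C_mul {P Q : H →L[ℂ] H} (h : Commute P Q) (p q : MvPolynomial (Fin 3) ℂ)
    (c : ℂ) : polyEval (p - MvPolynomial.C c * q) ![P, Q, P * Q] =
      polyEval p ![P, Q, P * Q] - c • polyEval q ![P, Q, P * Q] := by
  obtain ⟨A, _, _, _, φ, a, b, rfl, rfl, -⟩ := exists_commutative_banachAlgebra h
  have hT : (![φ a, φ b, φ a * φ b] : Fin 3 → (H →L[ℂ] H)) = fun i => φ (![a, b, a * b] i) := by
    ext1 i; fin_cases i <;> simp
  simp only [hT, polyEval_map, map_sub, map_mul, MvPolynomial.aeval_C,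
    Algebra.algebraMap_eq_smul_one, smul_mul_assoc, one_mul, map_smul]

/-- Von Neumann's inequality for commuting unitaries: the quotient `p(U) q(U)⁻¹` is normal, so its
norm is its spectral radius. -/
theorem norm_polyEval_mul_inverse_le {P Q : H →L[ℂ] H} (h : Commute P Q)
    (hP : P ∈ unitary (H →L[ℂ] H)) (hQ : Q ∈ unitary (H →L[ℂ] H))
    (p q : MvPolynomial (Fin 3) ℂ) {M : ℝ} (hM : 0 ≤ M)
    (hq : ∀ a b : ℂ, ‖a‖ ≤ 1 → ‖b‖ ≤ 1 → MvPolynomial.eval ![a, b, a * b] q ≠ 0)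
    (hpq : ∀ a b : ℂ, ‖a‖ ≤ 1 → ‖b‖ ≤ 1 →
      ‖MvPolynomial.eval ![a, b, a * b] p / MvPolynomial.eval ![a, b, a * b] q‖ ≤ M) :
    ‖polyEval p ![P, Q, P * Q] * Ring.inverse (polyEval q ![P, Q, P * Q])‖ ≤ M := by
  have hP1 : ‖P‖ ≤ 1 := norm_le_one_of_mem_unitary hP
  have hQ1 : ‖Q‖ ≤ 1 := norm_le_one_of_mem_unitary hQ
  obtain ⟨v, hv⟩ := isUnit_polyEval h hP1 hQ1 q hq
  set T : Fin 3 → (H →L[ℂ] H) := ![P, Q, P * Q] with hTdef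
  rw [← hv, Ring.inverse_unit]
  set X := polyEval p T * ↑v⁻¹ with hX
  have hcomm : ∀ {Y : H →L[ℂ] H}, Commute Y P → Commute Y Q → Commute Y X := by
    intro Y h1 h2
    have hY : ∀ i, Commute Y (T i) := by
      intro i
      fin_cases i
      exacts [h1, h2, h1.mul_right h2]
    refine (commute_polyEval hY p).mul_right (Commute.units_inv_right ?_)
    rw [hv]
    exact commute_polyEval hY q
  have hstar : ∀ {R Y : H →L[ℂ] H}, R ∈ unitary (H →L[ℂ] H) → Commute R Y →
      Commute (star R) Y := fun {R Y} hR hY => by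
    have : Commute (((Unitary.toUnits ⟨R, hR⟩)⁻¹ : (H →L[ℂ] H)ˣ) : H →L[ℂ] H) Y :=
      Commute.units_inv_left hY
    exact this
  have hXP : Commute P X := hcomm (Commute.refl P) h
  have hXQ : Commute Q X := hcomm h.symm (Commute.refl Q)
  have hn : IsStarNormal X := by
    refine ⟨hcomm ?_ ?_⟩
    · simpa using (hstar hP hXP).star_star.symm
    · simpa using (hstar hQ hXQ).star_star.symm
  have hrad : spectralRadius ℂ X ≤ ENNReal.ofReal M := by
    refine iSup₂_le fun l hl => ?_
    rw [← enorm_eq_nnnorm, ← ofReal_norm]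
    refine ENNReal.ofReal_le_ofReal ?_
    by_contra hlt
    push Not at hlt
    refine hl ?_
    have hu : IsUnit (polyEval (p - MvPolynomial.C l * q) T) := by
      refine isUnit_polyEval h hP1 hQ1 _ fun a b ha hb h0 => ?_
      have h1 := hpq a b ha hb
      rw [map_sub, map_mul, MvPolynomial.eval_C, sub_eq_zero] at h0
      rw [h0, mul_div_cancel_right₀ _ (hq a b ha hb)] at h1
      exact absurd h1 (not_le.2 hlt)
    rw [polyEval_sub_C_mul h, ← hTdef, ← hv] at hu
    have : algebraMap ℂ (H →L[ℂ] H) l - X = -((polyEval p T - l • (v : H →L[ℂ] H)) * ↑v⁻¹) := by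
      rw [sub_mul, smul_mul_assoc, Units.mul_inv, Algebra.algebraMap_eq_smul_one, hX]
      abel
    rw [spectrum.mem_resolventSet_iff, this]
    exact (hu.mul v⁻¹.isUnit).neg
  rw [IsStarNormal.spectralRadius_eq_nnnorm, ← enorm_eq_nnnorm, ← ofReal_norm] at hrad
  exact (ENNReal.ofReal_le_ofReal_iff hM).1 hrad

end FunctionalCalculus

/-! ### Restrictions of commuting unitaries -/

section TriangularIsometries

theorem mem_closedTetrablock {a b : ℂ} (ha : ‖a‖ ≤ 1) (hb : ‖b‖ ≤ 1) :
    ![a, b, a * b] ∈ closedTetrablock := by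
  have hc : Continuous fun x : ℂ × ℂ => (![x.1, x.2, x.1 * x.2] : Fin 3 → ℂ) := by
    refine continuous_pi fun i => ?_
    fin_cases i
    exacts [continuous_fst, continuous_snd, continuous_fst.mul continuous_snd]
  have hmem : (a, b) ∈ closure (Metric.ball (0 : ℂ × ℂ) 1) := by
    rw [closure_ball _ one_ne_zero]
    simpa [Prod.norm_def] using ⟨ha, hb⟩
  refine closure_mono ?_ (image_closure_subset_closure_image hc (Set.mem_image_of_mem _ hmem))
  rintro _ ⟨⟨x, y⟩, hxy, rfl⟩
  rw [mem_ball_zero_iff, Prod.norm_def] at hxy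
  refine ⟨Matrix.diagonal ![x, y], ?_, by simp⟩
  refine (Matrix.l2_opNorm_diagonal (𝕜 := ℂ) ![x, y]).trans_lt ?_
  rw [pi_norm_lt_iff one_pos]
  intro i
  fin_cases i
  exacts [(le_max_left _ _).trans_lt hxy, (le_max_right _ _).trans_lt hxy]

theorem isEUnitary_mul {L : Type u} [NormedAddCommGroup L] [InnerProductSpace ℂ L]
    [CompleteSpace L] {U₁ U₂ : L →L[ℂ] L} (h : Commute U₁ U₂) (h₁ : U₁ ∈ unitary (L →L[ℂ] L))
    (h₂ : U₂ ∈ unitary (L →L[ℂ] L)) : IsEUnitary ![U₁, U₂, U₁ * U₂] where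
  commute := IsCommutingTriple.of_commute h
  normal i := by
    have : ∀ {U : L →L[ℂ] L}, U ∈ unitary (L →L[ℂ] L) → IsStarNormal U := fun {U} hU =>
      ⟨hU.1.trans hU.2.symm⟩
    fin_cases i
    exacts [this h₁, this h₂, this (mul_mem h₁ h₂)]
  spectrum_subset z hz := by
    obtain ⟨hz0, hz1, hz2⟩ := mem_taylorSpectrum_mul h hz
    have hz0' : ‖z 0‖ = 1 := by simpa using spectrum.subset_circle_of_unitary h₁ hz0
    have hz1' : ‖z 1‖ = 1 := by simpa using spectrum.subset_circle_of_unitary h₂ hz1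
    have hz : z = ![z 0, z 1, z 0 * z 1] := by
      ext1 i
      fin_cases i
      exacts [rfl, rfl, hz2]
    refine ⟨hz ▸ mem_closedTetrablock hz0'.le hz1'.le, ?_⟩
    rw [hz2, norm_mul, hz0', hz1', one_mul]

/-- The restriction of a commuting pair of unitaries to a joint invariant subspace gives a
triangular `𝔼`-isometry: the von Neumann inequality is inherited from the unitaries. -/
theorem isTriangularEIsometry_of_unitary_extension {K L : Type u} [NormedAddCommGroup K]
    [InnerProductSpace ℂ K] [CompleteSpace K] [NormedAddCommGroup L] [InnerProductSpace ℂ L]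
    [CompleteSpace L] (j : K →ₗᵢ[ℂ] L) {V₁ V₂ : K →L[ℂ] K} {U₁ U₂ : L →L[ℂ] L}
    (h : Commute U₁ U₂) (hU₁ : U₁ ∈ unitary (L →L[ℂ] L)) (hU₂ : U₂ ∈ unitary (L →L[ℂ] L))
    (h₁ : ∀ x, U₁ (j x) = j (V₁ x)) (h₂ : ∀ x, U₂ (j x) = j (V₂ x)) :
    IsTriangularEIsometry ![V₁, V₂, V₁ * V₂] := by
  have hV : Commute V₁ V₂ := by
    ext x
    refine j.injective ?_
    simpa [h₁, h₂] using congr($h (j x))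
  have norm_le : ∀ {U : L →L[ℂ] L} {V : K →L[ℂ] K} {c : ℝ}, 0 ≤ c → ‖U‖ ≤ c →
      (∀ x, U (j x) = j (V x)) → ‖V‖ ≤ c := fun {U V c} hc hU hUV => by
    refine V.opNorm_le_bound hc fun x => ?_
    rw [← j.norm_map (V x), ← hUV, ← j.norm_map x]
    exact U.le_of_opNorm_le hU _
  have hV₁ := norm_le zero_le_one (norm_le_one_of_mem_unitary hU₁) h₁
  have hV₂ := norm_le zero_le_one (norm_le_one_of_mem_unitary hU₂) h₂
  have hT := IsCommutingTriple.of_commute hV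
  have hj : ∀ i x, (![U₁, U₂, U₁ * U₂] : Fin 3 → (L →L[ℂ] L)) i (j x) =
      j ((![V₁, V₂, V₁ * V₂] : Fin 3 → (K →L[ℂ] K)) i x) := by
    intro i x
    fin_cases i <;> simp [h₁, h₂]
  have hmem : ∀ a b : ℂ, ‖a‖ ≤ 1 → ‖b‖ ≤ 1 → ![a, b, a * b] ∈ closedTetrablock :=
    fun a b => mem_closedTetrablock
  refine ⟨⟨hT, fun z hz => ?_, fun q hq => ?_, fun p q hq M hM => ?_⟩,
    ⟨hT, L, _, _, ‹_›, j, _, isEUnitary_mul h hU₁ hU₂, hj⟩, V₁, V₂, hV, hV₁, hV₂, rfl⟩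
  · obtain ⟨hz0, hz1, hz2⟩ := mem_taylorSpectrum_mul hV hz
    have le_one : ∀ {V : K →L[ℂ] K} {c : ℂ}, ‖V‖ ≤ 1 → c ∈ spectrum ℂ V → ‖c‖ ≤ 1 :=
      fun {V c} hV hc => by
        have := spectrum.norm_le_norm_mul_of_mem hc
        refine this.trans (mul_le_one₀ hV (norm_nonneg _) ContinuousLinearMap.norm_id_le)
    have hz : z = ![z 0, z 1, z 0 * z 1] := by
      ext1 i
      fin_cases i
      exacts [rfl, rfl, hz2]
    exact hz ▸ mem_closedTetrablock (le_one hV₁ hz0) (le_one hV₂ hz1)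
  · exact isUnit_polyEval hV hV₁ hV₂ q fun a b ha hb => hq _ (hmem a b ha hb)
  · have hM0 : 0 ≤ M := (norm_nonneg _).trans
      (hM _ (hmem 0 0 (norm_zero.trans_le zero_le_one) (norm_zero.trans_le zero_le_one)))
    have hqV := isUnit_polyEval hV hV₁ hV₂ q fun a b ha hb => hq _ (hmem a b ha hb)
    have hqU := isUnit_polyEval h (norm_le_one_of_mem_unitary hU₁)
      (norm_le_one_of_mem_unitary hU₂) q fun a b ha hb => hq _ (hmem a b ha hb)
    refine norm_le hM0 (norm_polyEval_mul_inverse_le h hU₁ hU₂ p q hM0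
      (fun a b ha hb => hq _ (hmem a b ha hb)) fun a b ha hb => hM _ (hmem a b ha hb)) fun x => ?_
    have hinv : Ring.inverse (polyEval q ![U₁, U₂, U₁ * U₂]) (j x) =
        j (Ring.inverse (polyEval q ![V₁, V₂, V₁ * V₂]) x) := by
      have h3 := polyEval_intertwine j hj q (Ring.inverse (polyEval q ![V₁, V₂, V₁ * V₂]) x)
      have h4 := congr($(Ring.mul_inverse_cancel _ hqV) x)
      rw [mul_apply_eq_comp] at h4
      rw [h4] at h3
      rw [one_apply_eq_self] at h3
      rw [← h3]
      exact congr($(Ring.inverse_mul_cancel _ hqU) _)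
    rw [mul_apply_eq_comp, hinv, polyEval_intertwine j hj,
      mul_apply_eq_comp]

end TriangularIsometries

/-! ### Minimal dilations and purity -/

section MinimalDilation

variable {H : Type u} [NormedAddCommGroup H] [InnerProductSpace ℂ H]

theorem isClosed_setOf_tendsto_zero {K : Type u} [NormedAddCommGroup K] [InnerProductSpace ℂ K]
    {C : ℕ → (H →L[ℂ] K)} {c : ℝ} (hC : ∀ n x, ‖C n x‖ ≤ c * ‖x‖) :
    IsClosed {x : H | Tendsto (fun n => C n x) atTop (𝓝 0)} := by
  rw [← closure_subset_iff_isClosed]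
  intro x hx
  rw [Set.mem_ofPred_eq, Metric.tendsto_atTop]
  intro ε hε
  have hc : 0 < |c| + 1 := by positivity
  obtain ⟨y, hy, hxy⟩ := Metric.mem_closure_iff.1 hx (ε / 2 / (|c| + 1)) (by positivity)
  obtain ⟨N, hN⟩ := Metric.tendsto_atTop.1 hy (ε / 2) (half_pos hε)
  refine ⟨N, fun n hn => ?_⟩
  have h2 := hN n hn
  rw [dist_zero_right] at h2 ⊢
  rw [dist_eq_norm, lt_div_iff₀ hc] at hxy
  have h1 : c * ‖x - y‖ ≤ ‖x - y‖ * (|c| + 1) := by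
    nlinarith [le_abs_self c, norm_nonneg (x - y)]
  calc ‖C n x‖ = ‖C n (x - y) + C n y‖ := by rw [← map_add, sub_add_cancel]
    _ ≤ ‖C n (x - y)‖ + ‖C n y‖ := norm_add_le _ _
    _ < ε := by linarith [hC n (x - y)]

theorem norm_pow_apply_le {C : H →L[ℂ] H} (hC : ‖C‖ ≤ 1) (n : ℕ) (x : H) :
    ‖(C ^ n) x‖ ≤ 1 * ‖x‖ := by
  induction n with
  | zero => simp
  | succ n ih =>
    rw [pow_succ', mul_apply_eq_comp]
    exact (C.le_of_opNorm_le hC _).trans (by rwa [one_mul])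

theorem pow_mul_pow_mul_mul_pow {M : Type*} [Monoid M] {P Q : M} (h : Commute P Q) (a b n : ℕ) :
    P ^ a * Q ^ b * (P * Q) ^ n = P ^ (a + n) * Q ^ (b + n) := by
  rw [h.mul_pow, pow_add, pow_add, mul_assoc, ← mul_assoc (Q ^ b), (h.symm.pow_pow b n).eq]
  simp only [mul_assoc]

variable [CompleteSpace H]

/-- A dilation of `(P, Q)` to commuting unitaries restricts to the closed invariant subspace
generated by `H`, giving a triangular `𝔼`-isometry. By minimality the adjoints of the restrictions
extend `P*` and `Q*`, and so the product is pure when `PQ` is. -/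
theorem exists_isTriangularEIsometry_of_unitary_dilation {P Q : H →L[ℂ] H} (hPQ : Commute P Q)
    {L : Type u} [NormedAddCommGroup L] [InnerProductSpace ℂ L] [CompleteSpace L]
    (j : H →ₗᵢ[ℂ] L) {U₁ U₂ : L →L[ℂ] L} (h : Commute U₁ U₂) (hU₁ : U₁ ∈ unitary (L →L[ℂ] L))
    (hU₂ : U₂ ∈ unitary (L →L[ℂ] L))
    (hdil : ∀ a b x, ContinuousLinearMap.adjoint j.toContinuousLinearMap
      ((U₁ ^ a * U₂ ^ b) (j x)) = (P ^ a * Q ^ b) x) :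
    ∃ (K : Type u) (_ : NormedAddCommGroup K) (_ : InnerProductSpace ℂ K) (_ : CompleteSpace K)
      (i : H →ₗᵢ[ℂ] K) (V : Fin 3 → (K →L[ℂ] K)), IsTriangularEIsometry V ∧
        (IsPureContraction (P * Q) → IsPureContraction (V 2)) ∧
        IsDilation i V ![P, Q, P * Q] := by
  let S : Submodule ℂ L :=
    Submodule.span ℂ (Set.range fun t : ℕ × ℕ × H => (U₁ ^ t.1 * U₂ ^ t.2.1) (j t.2.2))
  let K := S.topologicalClosure
  have hgen : ∀ a b x, (U₁ ^ a * U₂ ^ b) (j x) ∈ K := fun a b x =>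
    S.le_topologicalClosure (Submodule.subset_span ⟨(a, b, x), rfl⟩)
  -- a closed subspace which contains the generators contains `K`
  have hmin : ∀ N : Submodule ℂ L, IsClosed (N : Set L) →
      (∀ a b x, (U₁ ^ a * U₂ ^ b) (j x) ∈ N) → K ≤ N := fun N hN hg => by
    refine S.topologicalClosure_minimal (Submodule.span_le.2 ?_) hN
    rintro _ ⟨t, rfl⟩
    exact hg _ _ _
  have hcl : IsClosed (K : Set L) := S.isClosed_topologicalClosure
  have hs₁ : ∀ a b, U₁ * (U₁ ^ a * U₂ ^ b) = U₁ ^ (a + 1) * U₂ ^ b := fun a b => by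
    rw [← mul_assoc, pow_succ']
  have hs₂ : ∀ a b, U₂ * (U₁ ^ a * U₂ ^ b) = U₁ ^ a * U₂ ^ (b + 1) := fun a b => by
    rw [← mul_assoc, (h.symm.pow_right a).eq, mul_assoc, pow_succ']
  have hK₁ : ∀ y ∈ K, U₁ y ∈ K := hmin (K.comap U₁.toLinearMap)
    (hcl.preimage U₁.continuous) fun a b x => by
      have := hgen (a + 1) b x
      rwa [← hs₁] at this
  have hK₂ : ∀ y ∈ K, U₂ y ∈ K := hmin (K.comap U₂.toLinearMap)
    (hcl.preimage U₂.continuous) fun a b x => by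
      have := hgen a (b + 1) x
      rwa [← hs₂] at this
  have : CompleteSpace K := hcl.completeSpace_coe
  let V₁ : K →L[ℂ] K := (U₁.comp K.subtypeL).codRestrict K fun y => hK₁ y y.2
  let V₂ : K →L[ℂ] K := (U₂.comp K.subtypeL).codRestrict K fun y => hK₂ y y.2
  have hj : ∀ x, j x ∈ K := fun x => by simpa using hgen 0 0 x
  let i : H →ₗᵢ[ℂ] K := ⟨j.toLinearMap.codRestrict K hj, fun x => j.norm_map x⟩
  have hV : IsTriangularEIsometry ![V₁, V₂, V₁ * V₂] :=
    isTriangularEIsometry_of_unitary_extension K.subtypeₗᵢ h hU₁ hU₂ (fun _ => rfl) fun _ => rfl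
  have hVc : Commute V₁ V₂ := by
    ext y
    exact congr($h y)
  have hpow : ∀ a b (y : K), (((V₁ ^ a * V₂ ^ b) y : K) : L) = (U₁ ^ a * U₂ ^ b) y := by
    intro a b y
    have h1 : ∀ a (y : K), (((V₁ ^ a) y : K) : L) = (U₁ ^ a) y := by
      intro a
      induction a with
      | zero => intro y; rfl
      | succ n ih => intro y; rw [pow_succ, pow_succ]; exact ih (V₁ y)
    have h2 : ∀ a (y : K), (((V₂ ^ a) y : K) : L) = (U₂ ^ a) y := by
      intro a
      induction a with
      | zero => intro y; rfl
      | succ n ih => intro y; rw [pow_succ, pow_succ]; exact ih (V₂ y)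
    rw [mul_apply_eq_comp, mul_apply_eq_comp, h1, h2]
  set π := ContinuousLinearMap.adjoint j.toContinuousLinearMap with hπ
  have hi : ∀ y : K, ContinuousLinearMap.adjoint i.toContinuousLinearMap y = π y := fun y => by
    refine ext_inner_left ℂ fun x => ?_
    rw [hπ, ContinuousLinearMap.adjoint_inner_right, ContinuousLinearMap.adjoint_inner_right]
    rfl
  have hV12 : ‖V₁ * V₂‖ ≤ 1 := by
    obtain ⟨A, B, -, hA, hB, hE⟩ := hV.isTriangular
    rw [show V₁ * V₂ = A * B from congr_fun hE 2]
    exact (norm_mul_le _ _).trans (mul_le_one₀ hA (norm_nonneg _) hB)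
  refine ⟨K, _, _, this, i, _, hV, fun hpure => ⟨hV12, ?_⟩, fun m₁ m₂ n x => ?_⟩
  · have hπ₁ : ∀ y ∈ K, π (U₁ y) = P (π y) := by
      refine hmin (LinearMap.eqLocus (π.comp U₁).toLinearMap (P.comp π).toLinearMap)
        (isClosed_eq (π.comp U₁).continuous (P.comp π).continuous) fun a b x => ?_
      change π ((U₁ * (U₁ ^ a * U₂ ^ b)) (j x)) = P (π ((U₁ ^ a * U₂ ^ b) (j x)))
      rw [hs₁, hdil, hdil, pow_succ', mul_assoc]
      rfl
    have hπ₂ : ∀ y ∈ K, π (U₂ y) = Q (π y) := by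
      refine hmin (LinearMap.eqLocus (π.comp U₂).toLinearMap (Q.comp π).toLinearMap)
        (isClosed_eq (π.comp U₂).continuous (Q.comp π).continuous) fun a b x => ?_
      change π ((U₂ * (U₁ ^ a * U₂ ^ b)) (j x)) = Q (π ((U₁ ^ a * U₂ ^ b) (j x)))
      rw [hs₂, hdil, hdil, pow_succ', ← mul_assoc, ← (hPQ.symm.pow_right a).eq, mul_assoc]
      rfl
    -- `Vᵢ*` extends `P*` and `Q*`, by the intertwining relations just proved
    have hadj : ∀ (V : K →L[ℂ] K) (R : H →L[ℂ] H), (∀ y : K, π (V y) = R (π y)) →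
        ∀ x, (star V) (i x) = i ((star R) x) := fun V R hVR x => by
      refine ext_inner_right ℂ fun y => ?_
      rw [ContinuousLinearMap.star_eq_adjoint, ContinuousLinearMap.star_eq_adjoint,
        ContinuousLinearMap.adjoint_inner_left]
      have e1 : ∀ (x : H) (y : K), inner ℂ (i x) y = inner ℂ x (π y) := fun x y => by
        rw [hπ, ContinuousLinearMap.adjoint_inner_right]
        rfl
      rw [e1, e1, hVR, ContinuousLinearMap.adjoint_inner_left]
    have ha₁ := hadj V₁ P fun y => hπ₁ y y.2
    have ha₂ := hadj V₂ Q fun y => hπ₂ y y.2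
    have hiso : ∀ {V : K →L[ℂ] K} {U : L →L[ℂ] L}, U ∈ unitary (L →L[ℂ] L) →
        (∀ y : K, ((V y : K) : L) = U y) → star V * V = 1 := fun {V U} hU hVU => by
      refine (ContinuousLinearMap.norm_map_iff_adjoint_comp_self V).1 fun y => ?_
      change ‖((V y : K) : L)‖ = ‖(y : L)‖
      rw [hVU]
      exact (ContinuousLinearMap.norm_map_iff_adjoint_comp_self U).2 hU.1 y
    have hi₁ : star V₁ * V₁ = 1 := hiso hU₁ fun _ => rfl
    have hi₂ : star V₂ * V₂ = 1 := hiso hU₂ fun _ => rfl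
    have hsc : Commute (star V₁) (star V₂) := hVc.star_star
    have hC : ContinuousLinearMap.adjoint (V₁ * V₂) = star V₁ * star V₂ := by
      rw [← ContinuousLinearMap.star_eq_adjoint, star_mul, hsc.eq]
    change ∀ y : K, Tendsto (fun n : ℕ => (ContinuousLinearMap.adjoint (V₁ * V₂) ^ n) y) atTop (𝓝 0)
    have hi_pow : ∀ (n : ℕ) (V : K →L[ℂ] K) (R : H →L[ℂ] H), (∀ x, V (i x) = i (R x)) →
        ∀ x, (V ^ n) (i x) = i ((R ^ n) x) := by
      intro n V R hVR
      induction n with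
      | zero => intro x; rfl
      | succ n ih => intro x; rw [pow_succ, pow_succ, mul_apply_eq_comp, hVR, ih]; rfl
    have hpre : ∀ x, Tendsto (fun n : ℕ => ((star V₁ * star V₂) ^ n) (i x)) atTop (𝓝 0) := by
      intro x
      have hx := (i.continuous.tendsto 0).comp (hpure.2 x)
      rw [map_zero] at hx
      refine hx.congr fun n => ?_
      rw [hi_pow n _ (ContinuousLinearMap.adjoint (P * Q))]
      · rfl
      · intro x
        rw [mul_apply_eq_comp, ha₂, ha₁, ← ContinuousLinearMap.star_eq_adjoint, hPQ.eq, star_mul]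
        rfl
    have hgen0 : ∀ a b x, Tendsto
        (fun n : ℕ => ((star V₁ * star V₂) ^ n) ((V₁ ^ a * V₂ ^ b) (i x))) atTop (𝓝 0) := by
      intro a b x
      rw [← tendsto_add_atTop_iff_nat (a + b)]
      refine (hpre ((star P ^ b * star Q ^ a) x)).congr fun n => ?_
      -- after `a + b` steps the generator `V₁ᵃ V₂ᵇ x` has been brought back into `H`
      have key : (star V₁ * star V₂) ^ (a + b) * (V₁ ^ a * V₂ ^ b) = star V₁ ^ b * star V₂ ^ a := by
        rw [hsc.mul_pow, (hsc.pow_pow _ _).eq, pow_add (star V₁), (Commute.pow_pow_self _ a b).eq,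
          mul_assoc, mul_assoc, ← mul_assoc (star V₁ ^ a), pow_mul_pow_eq_one a hi₁, one_mul,
          ← mul_assoc, ← (hsc.pow_pow _ _).eq, mul_assoc, pow_add, mul_assoc,
          pow_mul_pow_eq_one b hi₂, mul_one]
      have e : ∀ x : K, ((star V₁ * star V₂) ^ (n + (a + b))) ((V₁ ^ a * V₂ ^ b) x) =
          ((star V₁ * star V₂) ^ n) ((star V₁ ^ b * star V₂ ^ a) x) := fun x => by
        rw [← key, pow_add]
        rfl
      rw [e, mul_apply_eq_comp, mul_apply_eq_comp, hi_pow a _ _ ha₂, hi_pow b _ _ ha₁]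
    intro y
    rw [hC]
    have hCn : ‖star V₁ * star V₂‖ ≤ 1 := by
      rwa [← hC, ContinuousLinearMap.adjoint.norm_map]
    have hS : ∀ z ∈ S, ∀ hz : z ∈ K,
        Tendsto (fun n : ℕ => ((star V₁ * star V₂) ^ n) ⟨z, hz⟩) atTop (𝓝 0) := by
      intro z hz
      induction hz using Submodule.span_induction with
      | mem z hz =>
        obtain ⟨⟨a, b, x⟩, rfl⟩ := hz
        intro hz
        have := hgen0 a b x
        rwa [show (V₁ ^ a * V₂ ^ b) (i x) = ⟨_, hz⟩ from Subtype.ext (hpow a b (i x))] at this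
      | zero =>
        intro hz
        refine tendsto_const_nhds.congr fun n => (map_zero ((star V₁ * star V₂) ^ n)).symm
      | add z w hz hw h1 h2 =>
        intro _
        have := (h1 (S.le_topologicalClosure hz)).add (h2 (S.le_topologicalClosure hw))
        rw [add_zero] at this
        exact this.congr fun n => (map_add _ _ _).symm
      | smul c z hz h1 =>
        intro _
        have := (h1 (S.le_topologicalClosure hz)).const_smul c
        rw [smul_zero] at this
        exact this.congr fun n => (map_smul _ _ _).symm
    have hy : y ∈ closure ((↑) ⁻¹' (S : Set L) : Set K) := by
      have hsub : (S : Set L) ⊆ (fun z : K => (z : L)) '' {z : K | (z : L) ∈ S} :=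
        fun z hz => ⟨⟨z, S.le_topologicalClosure hz⟩, hz, rfl⟩
      exact closure_subtype.2 (closure_mono hsub y.2)
    exact (isClosed_setOf_tendsto_zero (norm_pow_apply_le hCn)).closure_subset_iff.2
      (fun z hz => hS z hz z.2) hy
  · change ContinuousLinearMap.adjoint i.toContinuousLinearMap
      ((V₁ ^ m₁ * V₂ ^ m₂ * (V₁ * V₂) ^ n) (i x)) = (P ^ m₁ * Q ^ m₂ * (P * Q) ^ n) x
    rw [pow_mul_pow_mul_mul_pow hVc, pow_mul_pow_mul_mul_pow hPQ, hi, hpow, ← hdil]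
    rfl

end MinimalDilation

/-! ### Extending commuting isometries to commuting unitaries -/

section UnitaryExtension

theorem withLp_prod_ext {F G : Type*} {z w : WithLp 2 (F × G)} (h₁ : z.fst = w.fst)
    (h₂ : z.snd = w.snd) : z = w :=
  WithLp.ofLp_injective 2 (Prod.ext h₁ h₂)

/-- Halmos' unitary dilation of a partial isometry `u`, given by the block matrix
`[[u, 1 - u u*], [1 - u* u, -u*]]`. -/
theorem exists_halmos_unitary {F : Type u} [NormedAddCommGroup F] [InnerProductSpace ℂ F]
    [CompleteSpace F] (u : F →L[ℂ] F) (hu : u * star u * u = u) :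
    ∃ W : WithLp 2 (F × F) ≃ₗᵢ[ℂ] WithLp 2 (F × F), ∀ x y, W (WithLp.toLp 2 (x, y)) =
      WithLp.toLp 2 (u x + (y - u (star u y)), x - star u (u x) - star u y) := by
  have huu : ∀ x, u (star u (u x)) = u x := fun x => congr($hu x)
  have hu' : star u * u * star u = star u := by simpa [mul_assoc] using congr(star $hu)
  have huu' : ∀ x, star u (u (star u x)) = star u x := fun x => congr($hu' x)
  -- the block matrix of `u`, whose inverse is the block matrix of `u*`
  have block : ∀ v w : F →L[ℂ] F, ∃ f : WithLp 2 (F × F) →ₗ[ℂ] WithLp 2 (F × F), ∀ z,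
      f z = WithLp.toLp 2 (v z.fst + (z.snd - v (w z.snd)), z.fst - w (v z.fst) - w z.snd) :=
    fun v w => ⟨{
      toFun := fun z =>
        WithLp.toLp 2 (v z.fst + (z.snd - v (w z.snd)), z.fst - w (v z.fst) - w z.snd)
      map_add' := fun z z' => by
        refine withLp_prod_ext ?_ ?_
        · simp only [WithLp.toLp_fst, WithLp.add_fst, WithLp.add_snd, map_add]
          abel
        · simp only [WithLp.toLp_snd, WithLp.add_fst, WithLp.add_snd, map_add]
          abel
      map_smul' := fun c z => by
        refine withLp_prod_ext ?_ ?_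
        · simp [smul_sub, smul_add]
        · simp [smul_sub] }, fun z => rfl⟩
  obtain ⟨f, hf⟩ := block u (star u)
  obtain ⟨g, hg⟩ := block (star u) u
  have hfg : ∀ z, f (g z) = z := fun z => by
    refine withLp_prod_ext ?_ ?_
    · simp [hf, hg, huu, huu']
    · simp [hf, hg, huu, huu']
  have hgf : ∀ z, g (f z) = z := fun z => by
    refine withLp_prod_ext ?_ ?_
    · simp [hf, hg, huu, huu']
    · simp [hf, hg, huu, huu']
  have pyth : ∀ x y : F, inner ℂ x y = 0 → ‖x + y‖ ^ 2 = ‖x‖ ^ 2 + ‖y‖ ^ 2 := fun x y hxy => by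
    simpa [sq] using norm_add_sq_eq_norm_sq_add_norm_sq_of_inner_eq_zero x y hxy
  have adj : ∀ x y, inner ℂ (u x) y = inner ℂ x (star u y) := fun x y => by
    rw [ContinuousLinearMap.star_eq_adjoint, ContinuousLinearMap.adjoint_inner_right]
  have adj' : ∀ x y, inner ℂ (star u x) y = inner ℂ x (u y) := fun x y => by
    rw [ContinuousLinearMap.star_eq_adjoint, ContinuousLinearMap.adjoint_inner_left]
  have hnorm : ∀ z, ‖f z‖ = ‖z‖ := fun z => by
    -- the summands of each coordinate are orthogonal, because `u u* u = u`
    -- makes `1 - u u*` and `1 - u* u` projections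
    have e1 := pyth (u z.fst) (z.snd - u (star u z.snd)) (by simp [adj, huu'])
    have e2 := pyth (star u z.snd) (-(z.fst - star u (u z.fst))) (by simp [adj', huu])
    have e3 := pyth (star u (u z.fst)) (z.fst - star u (u z.fst)) (by simp [adj', huu])
    have e4 := pyth (u (star u z.snd)) (z.snd - u (star u z.snd)) (by simp [adj, huu'])
    have n1 : ∀ x, ‖star u (u x)‖ = ‖u x‖ := fun x => by
      rw [← sq_eq_sq₀ (norm_nonneg _) (norm_nonneg _), @norm_sq_eq_re_inner ℂ,
        @norm_sq_eq_re_inner ℂ _ _ _ _ (u x), adj' _ (star u (u x)), huu]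
    have n2 : ‖u (star u z.snd)‖ = ‖star u z.snd‖ := by
      rw [← sq_eq_sq₀ (norm_nonneg _) (norm_nonneg _), @norm_sq_eq_re_inner ℂ,
        @norm_sq_eq_re_inner ℂ _ _ _ _ (star u z.snd), adj _ (u (star u z.snd)), huu']
    rw [← sq_eq_sq₀ (norm_nonneg _) (norm_nonneg _), hf, WithLp.prod_norm_sq_eq_of_L2,
      WithLp.prod_norm_sq_eq_of_L2]
    rw [← sub_eq_add_neg, norm_sub_rev, norm_neg] at e2
    rw [add_sub_cancel, n1] at e3
    rw [add_sub_cancel, n2] at e4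
    simp only [WithLp.toLp_fst, WithLp.toLp_snd]
    linarith
  exact ⟨⟨LinearEquiv.ofLinearMap f g (LinearMap.ext hfg) (LinearMap.ext hgf), hnorm⟩,
    fun x y => hf _⟩

variable {X Y : Type u} [NormedAddCommGroup X] [InnerProductSpace ℂ X] [NormedAddCommGroup Y]
  [InnerProductSpace ℂ Y]

theorem pow_apply_isometry {e : X →ₗᵢ[ℂ] Y} {W : Y ≃ₗᵢ[ℂ] Y} {V : X →L[ℂ] X}
    (hW : ∀ x, W (e x) = e (V x)) (n : ℕ) (x : X) : (W ^ n) (e x) = e ((V ^ n) x) := by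
  induction n generalizing x with
  | zero => rfl
  | succ n ih =>
    rw [pow_succ, pow_succ, LinearIsometryEquiv.coe_mul, Function.comp_apply, hW, ih]
    rfl

variable [CompleteSpace X] [CompleteSpace Y]

/-- Every isometry `V` extends to a unitary: Halmos' matrix `[[V, 1 - V V*], [0, -V*]]`. -/
theorem exists_unitary_extension_of_isometry {V : X →L[ℂ] X} (hV : ∀ x, ‖V x‖ = ‖x‖) :
    ∃ (Y : Type u) (_ : NormedAddCommGroup Y) (_ : InnerProductSpace ℂ Y) (_ : CompleteSpace Y)
      (e : X →ₗᵢ[ℂ] Y) (W : Y ≃ₗᵢ[ℂ] Y), ∀ x, W (e x) = e (V x) := by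
  have hV1 : star V * V = 1 := (ContinuousLinearMap.norm_map_iff_adjoint_comp_self V).1 hV
  obtain ⟨W, hW⟩ := exists_halmos_unitary V (by rw [mul_assoc, hV1, mul_one])
  refine ⟨WithLp 2 (X × X), inferInstance, inferInstance, inferInstance,
    ⟨{ toFun := fun x => WithLp.toLp 2 (x, 0), map_add' := ?_, map_smul' := ?_ }, ?_⟩, W, ?_⟩
  · intro x y
    refine withLp_prod_ext ?_ ?_ <;> simp
  · intro c x
    refine withLp_prod_ext ?_ ?_ <;> simp
  · intro x
    simp
  · intro x
    refine (hW x 0).trans ?_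
    have : star V (V x) = x := congr($hV1 x)
    simp [this]

/-- The vectors whose orbit under the unitary `W` approaches the range of `e`. When `e` intertwines
an isometry with `W`, this is the smallest reducing subspace of `W` which contains that range. -/
def asymptoticRange (e : X →ₗᵢ[ℂ] Y) (W : Y ≃ₗᵢ[ℂ] Y) : Submodule ℂ Y where
  carrier := {y | Tendsto (fun n : ℕ => (W ^ n) y -
    e (ContinuousLinearMap.adjoint e.toContinuousLinearMap ((W ^ n) y))) atTop (𝓝 0)}
  zero_mem' := by simp
  add_mem' {y z} hy hz := by
    have := Tendsto.add hy hz
    rw [add_zero] at this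
    refine this.congr fun n => ?_
    simp only [map_add]
    abel
  smul_mem' c y hy := by
    have := Tendsto.const_smul hy c
    rw [smul_zero] at this
    refine this.congr fun n => ?_
    simp only [map_smul, smul_sub]

theorem mem_asymptoticRange {e : X →ₗᵢ[ℂ] Y} {W : Y ≃ₗᵢ[ℂ] Y} {y : Y} :
    y ∈ asymptoticRange e W ↔ Tendsto (fun n : ℕ => (W ^ n) y -
      e (ContinuousLinearMap.adjoint e.toContinuousLinearMap ((W ^ n) y))) atTop (𝓝 0) := Iff.rfl

theorem adjoint_isometry_apply (e : X →ₗᵢ[ℂ] Y) (x : X) :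
    ContinuousLinearMap.adjoint e.toContinuousLinearMap (e x) = x := by
  have := (ContinuousLinearMap.norm_map_iff_adjoint_comp_self e.toContinuousLinearMap).1
    e.norm_map
  exact congr($this x)

theorem norm_adjoint_isometry_le (e : X →ₗᵢ[ℂ] Y) (y : Y) :
    ‖ContinuousLinearMap.adjoint e.toContinuousLinearMap y‖ ≤ ‖y‖ := by
  refine (ContinuousLinearMap.le_of_opNorm_le _ ?_ y).trans_eq (one_mul _)
  rw [ContinuousLinearMap.adjoint.norm_map]
  exact e.norm_toContinuousLinearMap_le

theorem isClosed_asymptoticRange (e : X →ₗᵢ[ℂ] Y) (W : Y ≃ₗᵢ[ℂ] Y) :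
    IsClosed (asymptoticRange e W : Set Y) := by
  refine isClosed_setOf_tendsto_zero (c := 2) (C := fun n =>
    (1 - e.toContinuousLinearMap.comp (ContinuousLinearMap.adjoint e.toContinuousLinearMap)).comp
      ((W ^ n : Y ≃ₗᵢ[ℂ] Y).toContinuousLinearEquiv : Y →L[ℂ] Y)) fun n y => ?_
  refine (norm_sub_le _ _).trans ?_
  have h1 : ‖(W ^ n) y‖ = ‖y‖ := (W ^ n).norm_map y
  have h2 := norm_adjoint_isometry_le e ((W ^ n) y)
  rw [← e.norm_map] at h2
  change ‖(W ^ n) y‖ + ‖e (ContinuousLinearMap.adjoint e.toContinuousLinearMap ((W ^ n) y))‖ ≤ _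
  linarith

theorem mem_asymptoticRange_of_eventually {e : X →ₗᵢ[ℂ] Y} {W : Y ≃ₗᵢ[ℂ] Y} {V : X →L[ℂ] X}
    (hW : ∀ x, W (e x) = e (V x)) {y : Y} {n : ℕ} {x : X} (h : (W ^ n) y = e x) :
    y ∈ asymptoticRange e W := by
  have key : ∀ k, ∃ x, (W ^ (k + n)) y = e x := by
    intro k
    induction k with
    | zero => exact ⟨x, by rwa [zero_add]⟩
    | succ k ih =>
      obtain ⟨x, hx⟩ := ih
      refine ⟨V x, ?_⟩
      rw [add_right_comm, pow_succ', LinearIsometryEquiv.coe_mul, Function.comp_apply, hx, hW]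
  rw [mem_asymptoticRange, ← tendsto_add_atTop_iff_nat n]
  refine tendsto_const_nhds.congr fun k => ?_
  obtain ⟨x, hx⟩ := key k
  rw [hx, adjoint_isometry_apply, sub_self]

/-- An operator `A` on `X`, compressed to the range of `e` and conjugated by the unitary `Wⁿ`. -/
def conjPow (e : X →ₗᵢ[ℂ] Y) (W : Y ≃ₗᵢ[ℂ] Y) (A : X →L[ℂ] X) (n : ℕ) : Y →L[ℂ] Y :=
  ((W ^ n : Y ≃ₗᵢ[ℂ] Y).symm.toContinuousLinearEquiv : Y →L[ℂ] Y).comp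
    ((e.toContinuousLinearMap.comp (A.comp
      (ContinuousLinearMap.adjoint e.toContinuousLinearMap))).comp
        ((W ^ n : Y ≃ₗᵢ[ℂ] Y).toContinuousLinearEquiv : Y →L[ℂ] Y))

theorem conjPow_apply (e : X →ₗᵢ[ℂ] Y) (W : Y ≃ₗᵢ[ℂ] Y) (A : X →L[ℂ] X) (n : ℕ) (y : Y) :
    conjPow e W A n y = (W ^ n).symm
      (e (A (ContinuousLinearMap.adjoint e.toContinuousLinearMap ((W ^ n) y)))) := rfl

/-- An isometry `A` commuting with `V` extends to the asymptotic range of a unitary extension `W` of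
`V`, as the strong limit of its conjugates by the powers of `W`. -/
theorem exists_tendsto_conjPow {e : X →ₗᵢ[ℂ] Y} {W : Y ≃ₗᵢ[ℂ] Y} {V A : X →L[ℂ] X}
    (hW : ∀ x, W (e x) = e (V x)) (hAV : Commute A V) (hA : ∀ x, ‖A x‖ = ‖x‖) :
    ∃ U : asymptoticRange e W →L[ℂ] asymptoticRange e W,
      ∀ y : asymptoticRange e W, Tendsto (fun n => conjPow e W A n y) atTop (𝓝 (U y : Y)) := by
  set π := ContinuousLinearMap.adjoint e.toContinuousLinearMap with hπ
  have hcauchy : ∀ y : asymptoticRange e W,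
      ∃ z, Tendsto (fun n => conjPow e W A n y) atTop (𝓝 z) := by
    intro y
    refine cauchySeq_tendsto_of_complete (Metric.cauchySeq_iff'.2 fun ε hε => ?_)
    obtain ⟨N, hN⟩ := Metric.tendsto_atTop.1 (mem_asymptoticRange.1 y.2) (ε / 2) (half_pos hε)
    refine ⟨N, fun n hn => ?_⟩
    obtain ⟨k, rfl⟩ := Nat.exists_eq_add_of_le' hn
    have h1 := hN _ hn
    have h2 := hN N le_rfl
    rw [dist_zero_right, ← hπ] at h1 h2
    -- with `rₙ = Wⁿ y - e π Wⁿ y`, the distance of the terms `k + N` and `N` is at most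
    -- `‖W ^ k r_N‖ + ‖r_(k + N)‖`
    have hsplit : (W ^ (k + N)) (y : Y) = (W ^ k) ((W ^ N) (y : Y)) := by rw [pow_add]; rfl
    have e1 : (W ^ (k + N)) (conjPow e W A (k + N) y) = e (A (π ((W ^ (k + N)) y))) :=
      LinearIsometryEquiv.apply_symm_apply _ _
    have e2 : (W ^ (k + N)) (conjPow e W A N y) = e (A ((V ^ k) (π ((W ^ N) y)))) := by
      rw [pow_add, LinearIsometryEquiv.coe_mul, Function.comp_apply, conjPow_apply,
        LinearIsometryEquiv.apply_symm_apply, pow_apply_isometry hW]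
      exact congr(e ($((hAV.pow_right k).symm) (π ((W ^ N) y))))
    have e3 : (W ^ k) ((W ^ N) (y : Y) - e (π ((W ^ N) y))) =
        (W ^ (k + N)) (y : Y) - e ((V ^ k) (π ((W ^ N) y))) := by
      rw [map_sub, ← hsplit, pow_apply_isometry hW]
    rw [dist_eq_norm, ← (W ^ (k + N)).norm_map, map_sub, e1, e2, ← map_sub, e.norm_map, ← map_sub,
      hA, ← e.norm_map, map_sub]
    rw [← (W ^ k).norm_map, e3] at h2
    calc _ = ‖((W ^ (k + N)) (y : Y) - e ((V ^ k) (π ((W ^ N) y)))) -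
          ((W ^ (k + N)) (y : Y) - e (π ((W ^ (k + N)) y)))‖ := by congr 1; abel
      _ ≤ _ := norm_sub_le _ _
      _ < ε := by linarith
  choose f hf using hcauchy
  have hmem : ∀ y, f y ∈ asymptoticRange e W := fun y => by
    refine (isClosed_asymptoticRange e W).mem_of_tendsto (hf y) (Eventually.of_forall fun n => ?_)
    exact mem_asymptoticRange_of_eventually hW (n := n) (LinearIsometryEquiv.apply_symm_apply _ _)
  have := (isClosed_asymptoticRange e W).completeSpace_coe
  let g : ℕ → asymptoticRange e W →L[ℂ] Y := fun n =>
    (conjPow e W A n).comp (asymptoticRange e W).subtypeL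
  exact ⟨(continuousLinearMapOfTendsto g (tendsto_pi_nhds.2 hf)).codRestrict _ hmem, hf⟩

/-- Itô's theorem for pairs: two commuting isometries extend to commuting unitaries. -/
theorem exists_commuting_unitary_extension {V₁ V₂ : X →L[ℂ] X} (h : Commute V₁ V₂)
    (h₁ : ∀ x, ‖V₁ x‖ = ‖x‖) (h₂ : ∀ x, ‖V₂ x‖ = ‖x‖) :
    ∃ (L : Type u) (_ : NormedAddCommGroup L) (_ : InnerProductSpace ℂ L) (_ : CompleteSpace L)
      (j : X →ₗᵢ[ℂ] L) (U₁ U₂ : L →L[ℂ] L), Commute U₁ U₂ ∧ U₁ ∈ unitary (L →L[ℂ] L) ∧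
        U₂ ∈ unitary (L →L[ℂ] L) ∧ (∀ x, U₁ (j x) = j (V₁ x)) ∧ ∀ x, U₂ (j x) = j (V₂ x) := by
  obtain ⟨Y, _, _, _, e, W, hW⟩ := exists_unitary_extension_of_isometry (V := V₁ * V₂)
    fun x => by rw [mul_apply_eq_comp, h₁, h₂]
  obtain ⟨U₁, hU₁⟩ := exists_tendsto_conjPow hW ((Commute.refl V₁).mul_right h) h₁
  obtain ⟨U₂, hU₂⟩ := exists_tendsto_conjPow hW (h.symm.mul_right (Commute.refl V₂)) h₂
  let L := asymptoticRange e W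
  set π := ContinuousLinearMap.adjoint e.toContinuousLinearMap with hπ
  have : CompleteSpace L := (isClosed_asymptoticRange e W).completeSpace_coe
  have hnorm : ∀ {A : X →L[ℂ] X} {U : L →L[ℂ] L}, (∀ x, ‖A x‖ = ‖x‖) →
      (∀ y : L, Tendsto (fun n => conjPow e W A n y) atTop (𝓝 (U y : Y))) → ∀ y, ‖U y‖ = ‖y‖ := by
    intro A U hA hU y
    refine tendsto_nhds_unique (hU y).norm ?_
    have h0 := (mem_asymptoticRange.1 y.2).norm
    rw [norm_zero, ← hπ] at h0
    rw [tendsto_iff_norm_sub_tendsto_zero]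
    refine squeeze_zero (fun n => norm_nonneg _) (fun n => ?_) h0
    have : ‖conjPow e W A n y‖ = ‖e (π ((W ^ n) y))‖ := by
      rw [conjPow_apply, LinearIsometryEquiv.norm_map, e.norm_map, e.norm_map, hA]
    rw [this, norm_sub_rev, Real.norm_eq_abs, Submodule.coe_norm, ← (W ^ n).norm_map]
    exact abs_norm_sub_norm_le _ _
  have hmul : ∀ {A B : X →L[ℂ] X} {U U' : L →L[ℂ] L}, A * B = V₁ * V₂ → (∀ x, ‖A x‖ = ‖x‖) →
      (∀ y : L, Tendsto (fun n => conjPow e W A n y) atTop (𝓝 (U y : Y))) →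
      (∀ y : L, Tendsto (fun n => conjPow e W B n y) atTop (𝓝 (U' y : Y))) →
      ∀ y : L, ((U (U' y) : L) : Y) = W y := by
    intro A B U U' hAB hA hU hU' y
    refine tendsto_nhds_unique (hU (U' y)) ?_
    have h0 := (mem_asymptoticRange.1 y.2).norm
    have h0' := (tendsto_const_nhds (x := ((U' y : L) : Y))).sub (hU' y) |>.norm
    rw [norm_zero, ← hπ] at h0
    rw [sub_self, norm_zero] at h0'
    have hsum := h0'.add h0
    rw [add_zero] at hsum
    rw [tendsto_iff_norm_sub_tendsto_zero]
    refine squeeze_zero (fun n => norm_nonneg _) (fun n => ?_) hsum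
    -- `conjPow A n ∘ conjPow B n = conjPow (A * B) n`, which differs from `W` at `y` by `‖rₙ‖`
    have e1 : ‖conjPow e W A n (U' y - conjPow e W B n y)‖ ≤ ‖(U' y : Y) - conjPow e W B n y‖ := by
      rw [conjPow_apply, LinearIsometryEquiv.norm_map, e.norm_map, hA]
      exact (norm_adjoint_isometry_le e _).trans_eq (LinearIsometryEquiv.norm_map _ _)
    have e2 : ‖conjPow e W A n (conjPow e W B n y) - W y‖ =
        ‖(W ^ n) (y : Y) - e (π ((W ^ n) y))‖ := by
      have hc : (W ^ n) (W (y : Y)) = W ((W ^ n) (y : Y)) := by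
        rw [← Function.comp_apply (f := ⇑(W ^ n)), ← LinearIsometryEquiv.coe_mul, ← pow_succ,
          pow_succ', LinearIsometryEquiv.coe_mul, Function.comp_apply]
      have hAB' : ∀ x, e (A (B x)) = W (e x) := fun x => by
        rw [hW, ← hAB]
        rfl
      rw [← (W ^ n).norm_map, map_sub, hc, conjPow_apply, conjPow_apply,
        LinearIsometryEquiv.apply_symm_apply, LinearIsometryEquiv.apply_symm_apply,
        adjoint_isometry_apply, hAB', ← map_sub, W.norm_map, norm_sub_rev]
    calc ‖conjPow e W A n (U' y) - W y‖
        = ‖conjPow e W A n (U' y - conjPow e W B n y) +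
            (conjPow e W A n (conjPow e W B n y) - W y)‖ := by rw [map_sub]; congr 1; abel
      _ ≤ _ := (norm_add_le _ _).trans (add_le_add e1 e2.le)
  have hWmem : ∀ y : L, ∃ z : L, W z = y := by
    intro y
    refine ⟨⟨W.symm y, ?_⟩, W.apply_symm_apply y⟩
    rw [mem_asymptoticRange, ← tendsto_add_atTop_iff_nat 1]
    refine (mem_asymptoticRange.1 y.2).congr fun n => ?_
    have : (W ^ (n + 1)) (W.symm (y : Y)) = (W ^ n) (y : Y) := by
      rw [pow_succ, LinearIsometryEquiv.coe_mul, Function.comp_apply, W.apply_symm_apply]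
    rw [this]
  have h12 := hmul rfl h₁ hU₁ hU₂
  have h21 := hmul h.eq.symm h₂ hU₂ hU₁
  have hunit : ∀ {U U' : L →L[ℂ] L}, (∀ y, ‖U y‖ = ‖y‖) →
      (∀ y : L, ((U (U' y) : L) : Y) = W y) → U ∈ unitary (L →L[ℂ] L) := by
    intro U U' hU hUU'
    have hs : star U * U = 1 := (ContinuousLinearMap.norm_map_iff_adjoint_comp_self U).1 hU
    refine ⟨hs, ?_⟩
    ext1 y
    obtain ⟨z, hz⟩ := hWmem y
    have hy : U (U' z) = y := Subtype.ext ((hUU' z).trans hz)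
    rw [← hy]
    exact congr(U ($hs (U' z)))
  have hext : ∀ {A : X →L[ℂ] X} {U : L →L[ℂ] L}, Commute A (V₁ * V₂) →
      (∀ y : L, Tendsto (fun n => conjPow e W A n y) atTop (𝓝 (U y : Y))) →
      ∀ x (hx : e x ∈ L), ((U ⟨e x, hx⟩ : L) : Y) = e (A x) := by
    intro A U hA hU x hx
    refine tendsto_nhds_unique (hU _) (tendsto_const_nhds.congr fun n => ?_)
    rw [conjPow_apply, LinearIsometryEquiv.eq_symm_apply, pow_apply_isometry hW,
      pow_apply_isometry hW, adjoint_isometry_apply]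
    exact congr(e ($((hA.pow_right n).symm) x))
  have hmemL : ∀ x, e x ∈ L := fun x => mem_asymptoticRange_of_eventually hW (n := 0) rfl
  refine ⟨L, inferInstance, inferInstance, this,
    ⟨e.toLinearMap.codRestrict L hmemL, fun x => e.norm_map x⟩, U₁, U₂, ?_,
    hunit (hnorm h₁ hU₁) h12, hunit (hnorm h₂ hU₂) h21, fun x => Subtype.ext ?_,
    fun x => Subtype.ext ?_⟩
  · ext1 y
    exact Subtype.ext ((h12 y).trans (h21 y).symm)
  · exact hext ((Commute.refl V₁).mul_right h) hU₁ x (hmemL x)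
  · exact hext (h.symm.mul_right (Commute.refl V₂)) hU₂ x (hmemL x)

end UnitaryExtension

/-! ### Isometries of `H ⊕ ℓ²(E)`, defect operators and partial isometries -/

section IsometricLift

theorem hasSum_norm_sq {E : Type u} [NormedAddCommGroup E]
    (x : lp (fun _ : ℕ => E) 2) : HasSum (fun n => ‖x n‖ ^ 2) (‖x‖ ^ 2) := by
  simpa using lp.hasSum_norm (p := 2) (by simp) x

variable {H : Type u} [NormedAddCommGroup H] [InnerProductSpace ℂ H]

section Sequences

variable {E : Type u} [NormedAddCommGroup E] [InnerProductSpace ℂ E]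

/-- An isometry of `H ⊕ ℓ²(E)` can be prescribed by its coordinates, as soon as the squares of
their norms have the right sum. -/
theorem exists_isometry_of_hasSum
    (T : H →L[ℂ] H) (c : WithLp 2 (H × lp (fun _ : ℕ => E) 2) →ₗ[ℂ] (ℕ → E))
    (hc : ∀ z, HasSum (fun n => ‖c z n‖ ^ 2) (‖z‖ ^ 2 - ‖T z.fst‖ ^ 2)) :
    ∃ R : WithLp 2 (H × lp (fun _ : ℕ => E) 2) →L[ℂ] WithLp 2 (H × lp (fun _ : ℕ => E) 2),
      (∀ z, ‖R z‖ = ‖z‖) ∧ (∀ z, (R z).fst = T z.fst) ∧ ∀ z n, (R z).snd n = c z n := by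
  have hmem : ∀ z, Memℓp (c z) 2 := fun z => memℓp_gen (by simpa using (hc z).summable)
  let f : WithLp 2 (H × lp (fun _ : ℕ => E) 2) →ₗ[ℂ] WithLp 2 (H × lp (fun _ : ℕ => E) 2) :=
    { toFun := fun z => WithLp.toLp 2 (T z.fst, ⟨c z, hmem z⟩)
      map_add' := fun z w => withLp_prod_ext (map_add T z.fst w.fst) (Subtype.ext (map_add c z w))
      map_smul' := fun k z =>
        withLp_prod_ext (map_smul T k z.fst) (Subtype.ext (map_smul c k z)) }
  have hf : ∀ z, ‖f z‖ = ‖z‖ := fun z => by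
    have h1 : ‖(f z).snd‖ ^ 2 = ‖z‖ ^ 2 - ‖T z.fst‖ ^ 2 := (hasSum_norm_sq _).unique (hc z)
    rw [← sq_eq_sq₀ (norm_nonneg _) (norm_nonneg _), WithLp.prod_norm_sq_eq_of_L2, h1]
    exact add_sub_cancel _ _
  exact ⟨(⟨f, hf⟩ : _ →ₗᵢ[ℂ] _).toContinuousLinearMap, hf, fun z => rfl, fun z n => rfl⟩

theorem exists_coordinatewise_isometry (W : E →ₗᵢ[ℂ] E) :
    ∃ R : WithLp 2 (H × lp (fun _ : ℕ => E) 2) →L[ℂ] WithLp 2 (H × lp (fun _ : ℕ => E) 2),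
      (∀ z, ‖R z‖ = ‖z‖) ∧ (∀ z, (R z).fst = z.fst) ∧ ∀ z n, (R z).snd n = W (z.snd n) := by
  refine exists_isometry_of_hasSum (E := E) 1
    { toFun := fun z n => W (z.snd n)
      map_add' := fun z w => funext fun n => map_add W (z.snd n) (w.snd n)
      map_smul' := fun k z => funext fun n => map_smul W k (z.snd n) } fun z => ?_
  simpa [WithLp.prod_norm_sq_eq_of_L2] using hasSum_norm_sq z.snd

/-- The isometry `(h, x) ↦ (T h, (a h + p x₀, q x₀ + p x₁, q x₁ + p x₂, …))` of `H ⊕ ℓ²(E)`, for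
complementary projections `p` and `q` and a defect operator `a` of `T` with values in the range
of `q`. -/
theorem exists_partial_shift {T : H →L[ℂ] H} {p q : E →L[ℂ] E} {a : H →L[ℂ] E}
    (hpq : ∀ z, p (q z) = 0) (hadd : ∀ z, p z + q z = z)
    (hnorm : ∀ z, ‖p z‖ ^ 2 + ‖q z‖ ^ 2 = ‖z‖ ^ 2)
    (hpa : ∀ h, p (a h) = 0) (ha : ∀ h, ‖a h‖ ^ 2 = ‖h‖ ^ 2 - ‖T h‖ ^ 2) :
    ∃ R : WithLp 2 (H × lp (fun _ : ℕ => E) 2) →L[ℂ] WithLp 2 (H × lp (fun _ : ℕ => E) 2),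
      (∀ z, ‖R z‖ = ‖z‖) ∧ (∀ z, (R z).fst = T z.fst) ∧
      (∀ z, (R z).snd 0 = a z.fst + p (z.snd 0)) ∧
      ∀ z n, (R z).snd (n + 1) = q (z.snd n) + p (z.snd (n + 1)) := by
  have horth : ∀ y z, p y = 0 → ‖y + p z‖ ^ 2 = ‖y‖ ^ 2 + ‖p z‖ ^ 2 := fun y z hy => by
    have hpp : p (p z) = p z := by
      have := congr(p $(hadd z))
      rwa [map_add, hpq, add_zero] at this
    have h1 := hadd (y + p z)
    rw [map_add, hy, hpp, zero_add, add_comm y, add_right_inj] at h1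
    rw [← hnorm (y + p z), map_add, hy, hpp, zero_add, add_comm y, h1, add_comm]
  obtain ⟨R, h1, h2, h3⟩ := exists_isometry_of_hasSum (E := E) T
    { toFun := fun z n => Nat.casesOn n (a z.fst) (fun m => q (z.snd m)) + p (z.snd n)
      map_add' := fun z w => funext fun n => by
        cases n with
        | zero => simp [add_add_add_comm]
        | succ n => simp [add_add_add_comm]
      map_smul' := fun k z => funext fun n => by
        cases n with
        | zero => simp
        | succ n => simp } (fun z => by
      have hs := hasSum_norm_sq z.snd
      have hp : Summable fun n => ‖p (z.snd n)‖ ^ 2 :=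
        Summable.of_nonneg_of_le (fun _ => sq_nonneg _)
          (fun n => (hnorm (z.snd n)) ▸ le_add_of_nonneg_right (sq_nonneg _)) hs.summable
      have hq : Summable fun n => ‖q (z.snd n)‖ ^ 2 :=
        Summable.of_nonneg_of_le (fun _ => sq_nonneg _)
          (fun n => (hnorm (z.snd n)) ▸ le_add_of_nonneg_left (sq_nonneg _)) hs.summable
      have htot := (hp.hasSum.add hq.hasSum).unique (by simpa only [hnorm] using hs)
      have hq' : HasSum
          (fun n : ℕ => ‖(Nat.casesOn n (a z.fst) (fun m => q (z.snd m)) : E)‖ ^ 2)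
          (‖a z.fst‖ ^ 2 + ∑' n, ‖q (z.snd n)‖ ^ 2) := by
        rw [← hasSum_nat_add_iff' 1]
        simpa using hq.hasSum
      have hsum := hq'.add hp.hasSum
      have hval : ‖a z.fst‖ ^ 2 + ∑' n, ‖q (z.snd n)‖ ^ 2 + ∑' n, ‖p (z.snd n)‖ ^ 2 =
          ‖z‖ ^ 2 - ‖T z.fst‖ ^ 2 := by
        rw [WithLp.prod_norm_sq_eq_of_L2, ha]
        linarith
      rw [hval] at hsum
      refine hsum.congr_fun fun n => ?_
      cases n with
      | zero => exact horth _ _ (hpa _)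
      | succ n => exact horth _ _ (hpq _))
  exact ⟨R, h1, h2, fun z => h3 z 0, fun z n => h3 z (n + 1)⟩

end Sequences

/-- If `‖A x‖ = ‖B x‖` for all `x`, the map `A x ↦ B x` extends to a partial isometry whose initial
space is the closure of the range of `A`. -/
theorem exists_partial_isometry {F : Type u} [NormedAddCommGroup F] [InnerProductSpace ℂ F]
    [CompleteSpace F] {A B : H →L[ℂ] F} (h : ∀ x, ‖A x‖ = ‖B x‖) :
    ∃ u : F →L[ℂ] F, u * star u * u = u ∧ (∀ x, u (A x) = B x) ∧
      ∀ x, star u (u (A x)) = A x := by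
  let M := (LinearMap.range A.toLinearMap).topologicalClosure
  have hM : IsClosed (M : Set F) := Submodule.isClosed_topologicalClosure _
  have : CompleteSpace M := hM.completeSpace_coe
  have hAM : ∀ x, A x ∈ M := fun x => Submodule.le_topologicalClosure _ ⟨x, rfl⟩
  let e : H →ₗ[ℂ] M := A.toLinearMap.codRestrict M hAM
  have hdense : DenseRange e := by
    intro y
    rw [closure_subtype]
    have hsub : (LinearMap.range A.toLinearMap : Set F) ⊆
        (fun z : M => (z : F)) '' Set.range e := by
      rintro _ ⟨x, rfl⟩
      exact ⟨e x, ⟨x, rfl⟩, rfl⟩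
    exact closure_mono hsub y.2
  let v : M →L[ℂ] F := B.toLinearMap.extendOfNorm e
  have hv : ∀ x, v (e x) = B x := fun x =>
    LinearMap.extendOfNorm_eq hdense ⟨1, fun y => by
      rw [one_mul]
      exact (h y).ge⟩ x
  have hv_norm : ∀ m, ‖v m‖ = ‖m‖ := fun m =>
    hdense.induction_on m (isClosed_eq v.continuous.norm continuous_norm) fun x => by
      rw [hv]
      exact (h x).symm
  have hv_inner : ∀ m m', inner ℂ (v m) (v m') = inner ℂ m m' := fun m m' =>
    (⟨v.toLinearMap, hv_norm⟩ : M →ₗᵢ[ℂ] F).inner_map_map m m'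
  let u : F →L[ℂ] F := v.comp M.orthogonalProjectionOnto
  have hu : ∀ x, star u (u x) = M.orthogonalProjectionOnto x := fun x => by
    refine ext_inner_right ℂ fun y => ?_
    rw [ContinuousLinearMap.star_eq_adjoint, ContinuousLinearMap.adjoint_inner_left]
    refine (hv_inner _ _).trans ?_
    exact M.inner_orthogonalProjectionOnto_eq_of_mem_left _ _
  have hproj : ∀ m : M, M.orthogonalProjectionOnto (m : F) = m :=
    Submodule.orthogonalProjectionOnto_mem_subspace_eq_self
  refine ⟨u, ?_, fun x => ?_, fun x => ?_⟩
  · ext x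
    change u (star u (u x)) = u x
    rw [hu]
    exact congr(v $(hproj _))
  · exact congr(v $(hproj (e x))).trans (hv x)
  · rw [hu]
    exact congr(($(hproj (e x)) : F))

variable [CompleteSpace H]

theorem exists_defect_operator {T : H →L[ℂ] H} (hT : ‖T‖ ≤ 1) :
    ∃ D : H →L[ℂ] H, ∀ x, ‖D x‖ ^ 2 = ‖x‖ ^ 2 - ‖T x‖ ^ 2 := by
  have hnorm : ∀ (S : H →L[ℂ] H) x, ‖S x‖ ^ 2 = (inner ℂ ((star S * S) x) x).re := fun S x => by
    rw [mul_apply_eq_comp, ContinuousLinearMap.star_eq_adjoint,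
      ContinuousLinearMap.adjoint_inner_left, @norm_sq_eq_re_inner ℂ]
    rfl
  have h0 : 0 ≤ 1 - star T * T := by
    rw [sub_nonneg]
    refine (CStarAlgebra.norm_le_one_iff_of_nonneg _ (star_mul_self_nonneg T)).1 ?_
    rw [CStarRing.norm_star_mul_self]
    exact mul_le_one₀ hT (norm_nonneg _) hT
  have hD : star (CFC.sqrt (1 - star T * T)) * CFC.sqrt (1 - star T * T) = 1 - star T * T := by
    rw [(IsSelfAdjoint.of_nonneg (CFC.sqrt_nonneg _)).star_eq]
    exact CFC.sqrt_mul_sqrt_self _ h0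
  refine ⟨CFC.sqrt (1 - star T * T), fun x => ?_⟩
  rw [hnorm, hD, hnorm T, sub_apply, inner_sub_left, one_apply_eq_self, Complex.sub_re,
    @norm_sq_eq_re_inner ℂ]
  rfl

end IsometricLift

/-! ### Ando's theorem -/

section AndoDilation

variable {H : Type u} [NormedAddCommGroup H] [InnerProductSpace ℂ H] [CompleteSpace H]

/-- Ando's unitary: it matches the two expressions `‖D_Q P h‖² + ‖D_P h‖²` and
`‖D_Q h‖² + ‖D_P Q h‖²` for the defect `‖h‖² - ‖PQ h‖²` of the product. Here `a` and `b` are the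
defect operators of `P` and `Q`, with values in the ranges of the complementary orthogonal
projections `q` and `p`. -/
theorem exists_ando_unitary {P Q : H →L[ℂ] H} (h : Commute P Q) (hP : ‖P‖ ≤ 1) (hQ : ‖Q‖ ≤ 1) :
    ∃ (E : Type u) (_ : NormedAddCommGroup E) (_ : InnerProductSpace ℂ E) (_ : CompleteSpace E)
      (p q : E →L[ℂ] E) (a b : H →L[ℂ] E) (W : E ≃ₗᵢ[ℂ] E),
      (∀ z, p (q z) = 0) ∧ (∀ z, q (p z) = 0) ∧ (∀ z, p z + q z = z) ∧
      (∀ z, ‖p z‖ ^ 2 + ‖q z‖ ^ 2 = ‖z‖ ^ 2) ∧ (∀ x, p (a x) = 0) ∧ (∀ x, q (b x) = 0) ∧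
      (∀ x, ‖a x‖ ^ 2 = ‖x‖ ^ 2 - ‖P x‖ ^ 2) ∧ (∀ x, ‖b x‖ ^ 2 = ‖x‖ ^ 2 - ‖Q x‖ ^ 2) ∧
      ∀ x, W (a x + b (P x)) = b x + a (Q x) := by
  obtain ⟨D₁, hD₁⟩ := exists_defect_operator hP
  obtain ⟨D₂, hD₂⟩ := exists_defect_operator hQ
  have mk : ∀ A B : H →L[ℂ] H, ∃ f : H →L[ℂ] WithLp 2 (H × H),
      ∀ x, f x = WithLp.toLp 2 (A x, B x) :=
    fun A B => ⟨((WithLp.prodContinuousLinearEquiv 2 ℂ H H).symm : H × H →L[ℂ]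
      WithLp 2 (H × H)).comp (A.prod B),
      fun x => rfl⟩
  obtain ⟨A, hA⟩ := mk (D₂ * P) D₁
  obtain ⟨B, hB⟩ := mk D₂ (D₁ * Q)
  obtain ⟨a, ha⟩ := mk 0 D₁
  obtain ⟨b, hb⟩ := mk D₂ 0
  let ι : WithLp 2 (H × H) →L[ℂ] WithLp 2 (WithLp 2 (H × H) × WithLp 2 (H × H)) :=
    ((WithLp.prodContinuousLinearEquiv 2 ℂ (WithLp 2 (H × H)) (WithLp 2 (H × H))).symm :
      WithLp 2 (H × H) × WithLp 2 (H × H) →L[ℂ]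
        WithLp 2 (WithLp 2 (H × H) × WithLp 2 (H × H))).comp
      (ContinuousLinearMap.inl ℂ (WithLp 2 (H × H)) (WithLp 2 (H × H)))
  have hι : ∀ y, ι y = WithLp.toLp 2 (y, 0) := fun y => rfl
  have hι_norm : ∀ y, ‖ι y‖ ^ 2 = ‖y‖ ^ 2 := fun y => by
    rw [hι, WithLp.prod_norm_sq_eq_of_L2]
    simp
  let p : WithLp 2 (WithLp 2 (H × H) × WithLp 2 (H × H)) →L[ℂ]
      WithLp 2 (WithLp 2 (H × H) × WithLp 2 (H × H)) :=
    (ι.comp (((WithLp.prodContinuousLinearEquiv 2 ℂ H H).symm : H × H →L[ℂ] WithLp 2 (H × H)).comp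
      ((ContinuousLinearMap.inl ℂ H H).comp (WithLp.fstL 2 ℂ H H)))).comp
        (WithLp.fstL 2 ℂ (WithLp 2 (H × H)) (WithLp 2 (H × H)))
  have hp : ∀ z, p z = WithLp.toLp 2 (WithLp.toLp 2 (z.fst.fst, 0), 0) := fun z => rfl
  have hq : ∀ z, (1 - p) z = WithLp.toLp 2 (WithLp.toLp 2 (0, z.fst.snd), z.snd) := fun z => by
    rw [sub_apply, one_apply_eq_self, hp]
    refine withLp_prod_ext (withLp_prod_ext ?_ ?_) ?_ <;> simp
  have hAB : ∀ x, ‖A x‖ = ‖B x‖ := fun x => by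
    rw [← sq_eq_sq₀ (norm_nonneg _) (norm_nonneg _), WithLp.prod_norm_sq_eq_of_L2,
      WithLp.prod_norm_sq_eq_of_L2, hA, hB]
    simp only [WithLp.toLp_fst, WithLp.toLp_snd, mul_apply_eq_comp, hD₁, hD₂]
    rw [show Q (P x) = P (Q x) from congr($h.symm x)]
    ring
  obtain ⟨u, hu, huA, huuA⟩ := exists_partial_isometry hAB
  obtain ⟨W, hW⟩ := exists_halmos_unitary u hu
  refine ⟨WithLp 2 (WithLp 2 (H × H) × WithLp 2 (H × H)), inferInstance, inferInstance,
    inferInstance, p, 1 - p, ι.comp a, ι.comp b, W,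
    fun z => ?_, fun z => ?_, fun z => ?_, fun z => ?_, fun x => ?_, fun x => ?_, fun x => ?_,
    fun x => ?_, fun x => ?_⟩
  · rw [hp, hq]
    refine withLp_prod_ext (withLp_prod_ext ?_ ?_) ?_ <;> simp
  · rw [hq, hp]
    refine withLp_prod_ext (withLp_prod_ext ?_ ?_) ?_ <;> simp
  · rw [sub_apply, one_apply_eq_self, add_sub_cancel]
  · rw [hp, hq]
    simp only [WithLp.prod_norm_sq_eq_of_L2, WithLp.toLp_fst, WithLp.toLp_snd, norm_zero]
    ring
  · rw [hp, ContinuousLinearMap.comp_apply, hι, ha]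
    refine withLp_prod_ext (withLp_prod_ext ?_ ?_) ?_ <;> simp
  · rw [hq, ContinuousLinearMap.comp_apply, hι, hb]
    refine withLp_prod_ext (withLp_prod_ext ?_ ?_) ?_ <;> simp
  · rw [ContinuousLinearMap.comp_apply, hι_norm, ha, ← hD₁, WithLp.prod_norm_sq_eq_of_L2]
    simp
  · rw [ContinuousLinearMap.comp_apply, hι_norm, hb, ← hD₂, WithLp.prod_norm_sq_eq_of_L2]
    simp
  · have hadd : ∀ y y', ι y + ι y' = ι (y + y') := fun y y' => (map_add ι y y').symm
    have e1 : (ι.comp a) x + (ι.comp b) (P x) = WithLp.toLp 2 (A x, 0) := by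
      rw [ContinuousLinearMap.comp_apply ι, ContinuousLinearMap.comp_apply ι, hadd, hι, ha, hb, hA]
      refine withLp_prod_ext (withLp_prod_ext ?_ ?_) ?_ <;> simp
    have e2 : (ι.comp b) x + (ι.comp a) (Q x) = WithLp.toLp 2 (B x, 0) := by
      rw [ContinuousLinearMap.comp_apply ι, ContinuousLinearMap.comp_apply ι, hadd, hι, ha, hb, hB]
      refine withLp_prod_ext (withLp_prod_ext ?_ ?_) ?_ <;> simp
    rw [e1, e2, hW, huA]
    have : star u (B x) = A x := by rw [← huA, huuA]
    simp [this]

/-- Ando's theorem, isometric form: commuting contractions lift to commuting isometries. -/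
theorem exists_commuting_isometric_lift {P Q : H →L[ℂ] H} (h : Commute P Q) (hP : ‖P‖ ≤ 1)
    (hQ : ‖Q‖ ≤ 1) :
    ∃ (X : Type u) (_ : NormedAddCommGroup X) (_ : InnerProductSpace ℂ X) (_ : CompleteSpace X)
      (e : H →ₗᵢ[ℂ] X) (V₁ V₂ : X →L[ℂ] X), Commute V₁ V₂ ∧ (∀ z, ‖V₁ z‖ = ‖z‖) ∧
        (∀ z, ‖V₂ z‖ = ‖z‖) ∧
        (∀ z, ContinuousLinearMap.adjoint e.toContinuousLinearMap (V₁ z) =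
          P (ContinuousLinearMap.adjoint e.toContinuousLinearMap z)) ∧
        ∀ z, ContinuousLinearMap.adjoint e.toContinuousLinearMap (V₂ z) =
          Q (ContinuousLinearMap.adjoint e.toContinuousLinearMap z) := by
  obtain ⟨E, _, _, _, p, q, a, b, W, hpq, hqp, hadd, hnorm, hpa, hqb, ha, hb, hW⟩ :=
    exists_ando_unitary h hP hQ
  obtain ⟨R₁, n₁, f₁, z₁, s₁⟩ := exists_partial_shift hpq hadd hnorm hpa ha
  obtain ⟨R₂, n₂, f₂, z₂, s₂⟩ := exists_partial_shift (p := q) (q := p) hqp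
    (fun z => by rw [add_comm, hadd]) (fun z => by rw [add_comm, hnorm]) hqb hb
  obtain ⟨G, nG, fG, cG⟩ := exists_coordinatewise_isometry (H := H) W.toLinearIsometry
  obtain ⟨G', nG', fG', cG'⟩ := exists_coordinatewise_isometry (H := H) W.symm.toLinearIsometry
  have hp : ∀ z, p (p z) = p z := fun z => by
    have := congr(p $(hadd z))
    rwa [map_add, hpq, add_zero] at this
  have hq : ∀ z, q (q z) = q z := fun z => by
    have := congr(q $(hadd z))
    rwa [map_add, hqp, zero_add] at this
  have hpb : ∀ x, p (b x) = b x := fun x => by simpa [hqb] using hadd (b x)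
  have hqa : ∀ x, q (a x) = a x := fun x => by simpa [hpa] using hadd (a x)
  have hext : ∀ {z w : WithLp 2 (H × lp (fun _ : ℕ => E) 2)}, z.fst = w.fst →
      (∀ n, z.snd n = w.snd n) → z = w := fun h1 h2 =>
    withLp_prod_ext h1 (lp.ext (funext h2))
  have hGG' : ∀ z, G (G' z) = z := fun z => hext (by rw [fG, fG']) fun n => by
    rw [cG, cG']
    exact W.apply_symm_apply _
  have hG'G : ∀ z, G' (G z) = z := fun z => hext (by rw [fG', fG]) fun n => by
    rw [cG', cG]
    exact W.symm_apply_apply _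
  -- both products shift the sequence by one step, and `W` matches the two entering vectors
  have hcomm : ∀ z, R₁ (R₂ (G z)) = G (R₂ (R₁ z)) := by
    intro z
    refine hext ?_ fun n => ?_
    · rw [f₁, f₂, fG, fG, f₂, f₁]
      exact congr($h z.fst)
    · rcases n with _ | _ | n
      · rw [z₁, z₂, f₂, cG, cG, z₂, z₁, f₁, map_add p, map_add q, hpq, hpb, hqp, hqa, add_zero,
          add_zero, fG]
        refine Eq.trans ?_ ((hW z.fst).symm.trans ?_)
        · rw [add_comm]
        · rw [add_comm]
          rfl
      · rw [s₁, s₂, z₂, cG, cG, cG, s₂, z₁, s₁]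
        simp only [map_add, hpq, hqp, hqb, hpa, hp, hq, zero_add, add_zero]
        rw [add_comm, hadd]
        exact congr(W $((hadd _).symm)).trans (map_add W _ _)
      · rw [s₁, s₂, s₂, cG, cG, cG, cG, s₂, s₁, s₁]
        simp only [map_add, hpq, hqp, hp, hq, zero_add, add_zero]
        rw [add_comm, hadd]
        exact congr(W $((hadd _).symm)).trans (map_add W _ _)
  let e : H →ₗᵢ[ℂ] WithLp 2 (H × lp (fun _ : ℕ => E) 2) :=
    ⟨{ toFun := fun x => WithLp.toLp 2 (x, 0)
       map_add' := fun x y => withLp_prod_ext rfl (add_zero _).symm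
       map_smul' := fun c x => withLp_prod_ext rfl (smul_zero _).symm }, fun x => by simp⟩
  have he : ∀ z, ContinuousLinearMap.adjoint e.toContinuousLinearMap z = z.fst := fun z => by
    refine ext_inner_left ℂ fun x => ?_
    rw [ContinuousLinearMap.adjoint_inner_right, WithLp.prod_inner_apply]
    simp [e]
  refine ⟨_, inferInstance, inferInstance, inferInstance, e, R₁ * G', G * R₂, ?_, fun z => ?_,
    fun z => ?_, fun z => ?_, fun z => ?_⟩
  · ext1 z
    simp only [mul_apply_eq_comp, hG'G]
    rw [← hcomm, hGG']
  · rw [mul_apply_eq_comp, n₁, nG']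
  · rw [mul_apply_eq_comp, nG, n₂]
  · rw [he, he, mul_apply_eq_comp, f₁, fG']
  · rw [he, he, mul_apply_eq_comp, fG, f₂]

/-- Ando's theorem: commuting contractions have a commuting unitary dilation. -/
theorem exists_commuting_unitary_dilation {P Q : H →L[ℂ] H} (h : Commute P Q) (hP : ‖P‖ ≤ 1)
    (hQ : ‖Q‖ ≤ 1) :
    ∃ (L : Type u) (_ : NormedAddCommGroup L) (_ : InnerProductSpace ℂ L) (_ : CompleteSpace L)
      (j : H →ₗᵢ[ℂ] L) (U₁ U₂ : L →L[ℂ] L), Commute U₁ U₂ ∧ U₁ ∈ unitary (L →L[ℂ] L) ∧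
        U₂ ∈ unitary (L →L[ℂ] L) ∧
        ∀ a b x, ContinuousLinearMap.adjoint j.toContinuousLinearMap ((U₁ ^ a * U₂ ^ b) (j x)) =
          (P ^ a * Q ^ b) x := by
  obtain ⟨X, _, _, _, e, V₁, V₂, hV, hV₁, hV₂, hP', hQ'⟩ := exists_commuting_isometric_lift h hP hQ
  obtain ⟨L, _, _, _, i, U₁, U₂, hU, hU₁, hU₂, h₁, h₂⟩ :=
    exists_commuting_unitary_extension hV hV₁ hV₂
  refine ⟨L, _, _, ‹_›, i.comp e, U₁, U₂, hU, hU₁, hU₂, fun a b x => ?_⟩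
  have hpow : ∀ {A : X →L[ℂ] X} {U : L →L[ℂ] L}, (∀ x, U (i x) = i (A x)) →
      ∀ n x, (U ^ n) (i x) = i ((A ^ n) x) := by
    intro A U hUA n
    induction n with
    | zero => intro x; rfl
    | succ n ih =>
      intro x
      rw [pow_succ, pow_succ, mul_apply_eq_comp, hUA, ih]
      rfl
  have hpow' : ∀ {A : X →L[ℂ] X} {R : H →L[ℂ] H},
      (∀ z, ContinuousLinearMap.adjoint e.toContinuousLinearMap (A z) =
        R (ContinuousLinearMap.adjoint e.toContinuousLinearMap z)) →
      ∀ n z, ContinuousLinearMap.adjoint e.toContinuousLinearMap ((A ^ n) z) =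
        (R ^ n) (ContinuousLinearMap.adjoint e.toContinuousLinearMap z) := by
    intro A R hAR n
    induction n with
    | zero => intro x; rfl
    | succ n ih =>
      intro x
      rw [pow_succ, pow_succ, mul_apply_eq_comp, ih, hAR]
      rfl
  have hadj : ∀ y, ContinuousLinearMap.adjoint (i.comp e).toContinuousLinearMap y =
      ContinuousLinearMap.adjoint e.toContinuousLinearMap
        (ContinuousLinearMap.adjoint i.toContinuousLinearMap y) := fun y =>
    congr($(ContinuousLinearMap.adjoint_comp i.toContinuousLinearMap e.toContinuousLinearMap) y)
  rw [hadj, mul_apply_eq_comp, LinearIsometry.coe_comp, Function.comp_apply, hpow h₂, hpow h₁,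
    adjoint_isometry_apply, hpow' hP', hpow' hQ', adjoint_isometry_apply]
  rfl

end AndoDilation

end TetrablockOperators

end

open TetrablockOperators in
theorem theorem3 {H : Type u} [NormedAddCommGroup H] [InnerProductSpace ℂ H] [CompleteSpace H]
    (T : Fin 3 → (H →L[ℂ] H)) (hT : IsTriangularEContraction T) :
    (∃ (K : Type u) (_ : NormedAddCommGroup K) (_ : InnerProductSpace ℂ K) (_ : CompleteSpace K)
      (j : H →ₗᵢ[ℂ] K) (V : Fin 3 → (K →L[ℂ] K)),
      IsTriangularEIsometry V ∧ IsDilation j V T) ∧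
    (IsPureContraction (T 2) →
      ∃ (K : Type u) (_ : NormedAddCommGroup K) (_ : InnerProductSpace ℂ K) (_ : CompleteSpace K)
        (j : H →ₗᵢ[ℂ] K) (V : Fin 3 → (K →L[ℂ] K)),
        IsTriangularEIsometry V ∧ IsPureContraction (V 2) ∧ IsDilation j V T) := by
  obtain ⟨P, Q, h, hP, hQ, rfl⟩ := hT.2
  obtain ⟨L, _, _, _, j, U₁, U₂, hU, hU₁, hU₂, hdil⟩ := exists_commuting_unitary_dilation h hP hQ
  obtain ⟨K, _, _, _, i, V, hV, hpure, hi⟩ :=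
    exists_isTriangularEIsometry_of_unitary_dilation h j hU hU₁ hU₂ hdil
  exact ⟨⟨K, _, _, ‹_›, i, V, hV, hi⟩, fun hT2 => ⟨K, _, _, ‹_›, i, V, hV, hpure hT2, hi⟩⟩
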